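/- Let $m\ge 1$ be an integer (market size), $\alpha>0$, $\beta\ge 0$, $T\ge 0$, and $\lambda(p,x)=m e^{-p}(\alpha+\beta x)(1-x)$. *Deterministic Bass model:* a price trajectory $(p_t)_{t\in[0,T]}$ generates adoption levels by $m\,\frac{dX_t}{dt}=\lambda(p_t,X_t)$, $X_0=0$, and earns $m\int_0^T p_t\,dX_t$; let $V^{\mathrm{det}}(T)$ be the optimal (supremal) revenue over all price trajectories. *Stochastic Bass model:* customers arrive one at a time; a (possibly randomized) pricing policy posts at each time $t$ a price $p_t$ depending on $t$ and on the past arrival times, and, given the past, the next customer arrives with rate $\lambda(p_t,d_t/m)$, where $d_t$ is the number of arrivals so far; each arriving customer pays the posted price, $\mathrm{Rev}(T)$ is the sum of the prices paid up to time $T$, and $V^{\mathrm{stoch}}(T)$ is the optimal (supremal) value of $\mathbb E[\mathrm{Rev}(T)]$ over all policies. (Prices are measurable and $e^{-p_t}$ is integrable over $[0,T]$.) For a policy put $$\text{Regret}(T)=V^{\mathrm{stoch}}(T)-\mathrm{Rev}(T),\qquad \text{Pseudo-Regret}(T)=V^{\mathrm{det}}(T)-\mathrm{Rev}(T).$$ Both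 suprema are finite, and for every $T\ge 0$, every policy and every realization, $$\text{Pseudo-Regret}(T)\ \ge\ \text{Regret}(T),\qquad\text{i.e. } V^{\mathrm{det}}(T)\ge V^{\mathrm{stoch}}(T).$$ Moreover, for every $\rho$ there are constants $C$ and $k$, depending only on $\rho$, such that for all $m\ge 2$, $\alpha>0$, $0\le\beta\le\rho\alpha$ and $T\ge 0$, with $L=\max\{0,\log((\alpha+\beta)T)\}$ ($L=0$ for $T=0$) and the convention $0\cdot\log^2 0=0$, for every policy and every realization, $$\text{Pseudo-Regret}(T)\ \le\ \text{Regret}(T)+C\left(\sqrt m\,\log^2 m+L\,\log^2(mL)\right),$$ and hence $|\text{Pseudo-Regret}(T)-\text{Regret}(T)|\le C\sqrt m\,(\log m+L)^k=\tilde O(\sqrt m)$. -/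

import Mathlib

open MeasureTheory ProbabilityTheory

namespace Bass

/-- The Bass adoption rate `λ(p, x) = m e^{-p} (α + β x) (1 - x)` at price `p` and adoption
level `x`, in a market of size `m`. -/
noncomputable def rate (m : ℕ) (α β p x : ℝ) : ℝ :=
  m * Real.exp (-p) * (α + β * x) * (1 - x)

/-! ### The deterministic model -/

/-- `(p, X)` is a price trajectory on `[0, T]` (with integrable adoption rate) together with the
adoption levels that it generates: `m dX_t/dt = λ(p_t, X_t)`, `X_0 = 0`. The differential equation
is written in integrated form, since prices need only be measurable in time. -/
structure IsDetTrajectory (m : ℕ) (α β T : ℝ) (p X : ℝ → ℝ) : Prop where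
  measurable : Measurable p
  integrable : IntervalIntegrable (fun t => Real.exp (-(p t))) volume 0 T
  continuousOn : ContinuousOn X (Set.Icc 0 T)
  mem_Icc : ∀ t ∈ Set.Icc 0 T, X t ∈ Set.Icc (0 : ℝ) 1
  adoption : ∀ t ∈ Set.Icc 0 T, m * X t = ∫ s in (0 : ℝ)..t, rate m α β (p s) (X s)

/-- The total revenues `m ∫_0^T p_t dX_t = ∫_0^T p_t λ(p_t, X_t) dt` of all price trajectories of
the deterministic model (for which this integral exists). -/
def detRevenues (m : ℕ) (α β T : ℝ) : Set ℝ :=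
  {v | ∃ p X : ℝ → ℝ, IsDetTrajectory m α β T p X ∧
    IntervalIntegrable (fun t => p t * rate m α β (p t) (X t)) volume 0 T ∧
    v = ∫ t in (0 : ℝ)..T, p t * rate m α β (p t) (X t)}

/-- `V^det(T)`: the optimal revenue in the deterministic model. -/
noncomputable def VDet (m : ℕ) (α β T : ℝ) : ℝ := sSup (detRevenues m α β T)

/-! ### The stochastic model -/

/-- A (possibly randomized) dynamic pricing policy on `[0, T]`: `price n u h t` is the price posted
at time `t` when exactly `n` customers arrived before `t`, at the times `h 0, …, h (n - 1)`, and
`u` is the private random seed of the seller. Along every history the adoption rate is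
integrable over `[0, T]`; this is automatic when prices are bounded below. -/
structure Policy (T : ℝ) where
  price : (n : ℕ) → unitInterval → (Fin n → ℝ) → ℝ → ℝ
  measurable : ∀ n, Measurable
    (fun z : unitInterval × (Fin n → ℝ) × ℝ => price n z.1 z.2.1 z.2.2)
  integrable : ∀ n u h,
    IntervalIntegrable (fun t => Real.exp (-(price n u h t))) volume 0 T

/-- The price in force at time `t`. After the horizon, where it no longer affects the revenue, the
process is continued with price `0`, so that all arrival times are finite. -/
noncomputable def Policy.posted {T : ℝ} (π : Policy T) (n : ℕ) (u : unitInterval)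
    (h : Fin n → ℝ) (t : ℝ) : ℝ :=
  if t ≤ T then π.price n u h t else 0

/-- The time of the last arrival in a history of `n` arrivals (`0` if there was none). -/
def lastTime : (n : ℕ) → (Fin n → ℝ) → ℝ
  | 0, _ => 0
  | n + 1, h => h (Fin.last n)

/-- The next arrival after a history `h` of `n` arrivals: the first time at which the
adoption rate `λ_t = λ(p_t, n / m)`, integrated from the last arrival on, reaches the level `e`.
For `e` exponentially distributed with mean `1` and independent of the past, the next arrival time
`τ` thus satisfies `P(τ > t | h) = exp (- ∫ λ_s ds)`, the integral taken from the last arrival to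
`t`: given the past, arrivals occur with rate `λ_t`. -/
noncomputable def nextArrival (m : ℕ) (α β : ℝ) {T : ℝ} (π : Policy T) (u : unitInterval)
    (n : ℕ) (h : Fin n → ℝ) (e : ℝ) : ℝ :=
  sInf {t | lastTime n h ≤ t ∧
    e ≤ ∫ s in lastTime n h..t, rate m α β (π.posted n u h s) ((n : ℝ) / m)}

/-- The sample space: the seed of the seller and the exponential clocks of the arrivals. -/
abbrev Sample : Type := unitInterval × (ℕ → ℝ)

instance instIsProbabilityMeasureExpOne : IsProbabilityMeasure (expMeasure 1) :=
  isProbabilityMeasure_expMeasure one_pos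

/-- Seed uniform on `[0, 1]`, clocks i.i.d. exponential with mean `1`, all independent. -/
noncomputable def sampleMeasure : Measure Sample :=
  (volume : Measure unitInterval).prod (Measure.infinitePi (fun _ : ℕ => expMeasure 1))

/-- The arrival times `τ_1, …, τ_n` of the first `n` customers (meant for `n ≤ m`). -/
noncomputable def arrivals (m : ℕ) (α β : ℝ) {T : ℝ} (π : Policy T) (ω : Sample) :
    (n : ℕ) → Fin n → ℝ
  | 0 => Fin.elim0
  | n + 1 => Fin.snoc (arrivals m α β π ω n)
      (nextArrival m α β π ω.1 n (arrivals m α β π ω n) (ω.2 n))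

/-- The arrival time `τ_{n+1}` of customer `n + 1`. -/
noncomputable def arrivalTime (m : ℕ) (α β : ℝ) {T : ℝ} (π : Policy T) (ω : Sample) (n : ℕ) : ℝ :=
  nextArrival m α β π ω.1 n (arrivals m α β π ω n) (ω.2 n)

open Classical in
/-- The revenue `Rev(T)`: the sum of the prices paid by the customers who arrive in `[0, T]`. -/
noncomputable def revenue (m : ℕ) (α β : ℝ) {T : ℝ} (π : Policy T) (ω : Sample) : ℝ :=
  ∑ n ∈ Finset.range m,
    if arrivalTime m α β π ω n ≤ T then
      π.price n ω.1 (arrivals m α β π ω n) (arrivalTime m α β π ω n)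
    else 0

/-- The expected revenues `E[Rev(T)]` of all dynamic pricing policies (for which it exists). -/
def stochRevenues (m : ℕ) (α β T : ℝ) : Set ℝ :=
  {v | ∃ π : Policy T, Integrable (revenue m α β π) sampleMeasure ∧
    v = ∫ ω, revenue m α β π ω ∂sampleMeasure}

/-- `V^stoch(T)`: the optimal expected revenue in the stochastic model. -/
noncomputable def VStoch (m : ℕ) (α β T : ℝ) : ℝ := sSup (stochRevenues m α β T)

/-! ### Regret -/

/-- `Regret(T) = V^stoch(T) - Rev(T)`, a random variable. -/
noncomputable def regret (m : ℕ) (α β : ℝ) {T : ℝ} (π : Policy T) (ω : Sample) : ℝ :=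
  VStoch m α β T - revenue m α β π ω

/-- `Pseudo-Regret(T) = V^det(T) - Rev(T)`, a random variable. -/
noncomputable def pseudoRegret (m : ℕ) (α β : ℝ) {T : ℝ} (π : Policy T) (ω : Sample) : ℝ :=
  VDet m α β T - revenue m α β π ω

end Bass

/-! ### Integration by parts against a survival function, and the law of a hitting time with given
hazard rate. -/

section HittingTime

open Set Filter Topology

/-! The revenue cancels in the difference of pseudo-regret and regret, so everything is about the
deterministic quantity `VDet - VStoch`. It is nonnegative, and it is in fact at most `|ρ| + 2 + log
m`, which is stronger than the claimed bounds; horizon terms are not needed.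

Write g(x) = (α + βx)(1 - x). The optimal deterministic trajectory adopts at constant speed r =
g(y)/e, where its endpoint y solves e y = T g(y), and its price is 1 - s with shadow price s(t) =
log g(y) - log g(rt). Optimality (`detRevenues_le`) needs two tangent inequalities, 1 + x ≤ exp x
for the price and concavity of g for the adoption level; the remaining term is the derivative of
s(t)(X_t - rt), which integrates to 0.

The same data give an upper bound for the stochastic model. With R the remaining deterministic
revenue per potential customer, m R(t) + s(t)(n - m r t) is a supersolution of the
Hamilton-Jacobi-Bellman equation -W_n' = q_n exp(W_{n+1} - W_n - 1), q_n the arrival rate at price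
0, again by concavity of g. Verification (`integral_revenue_le`) yields `VStoch ≤ VDet`.

For the converse, E_n = exp W_n turns that equation into the linear system E_n' = (q_n/e) E_{n+1} in
remaining time, solved by polynomials with nonnegative coefficients. The resulting policy earns log
E_0(T), so log E_0(T) ≤ `VStoch`. Keeping one monomial of E_0 bounds log E_0(T) below by a sum of
log(mT/e) + log g(j/m) - log(j+1) over j < k. With z = my, `VDet` equals z - z log z plus the
integral of log(mT/e) + log g(u/m) over [0, z]; taking k next to z, a one-sided Riemann sum estimate
and a Stirling bound give `mul_revenueToGo_le`. -/

theorem AbsolutelyContinuousOnInterval.of_dist_le {f g : ℝ → ℝ} {a b : ℝ}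
    (hf : AbsolutelyContinuousOnInterval f a b)
    (h : ∀ x ∈ uIcc a b, ∀ y ∈ uIcc a b, dist (g x) (g y) ≤ dist (f x) (f y)) :
    AbsolutelyContinuousOnInterval g a b := by
  refine squeeze_zero' (Eventually.of_forall fun E => Finset.sum_nonneg fun _ _ => dist_nonneg)
    ?_ hf
  have hE : ∀ᶠ E : ℕ × (ℕ → ℝ × ℝ) in AbsolutelyContinuousOnInterval.totalLengthFilter ⊓
      𝓟 (AbsolutelyContinuousOnInterval.disjWithin a b),
      E ∈ AbsolutelyContinuousOnInterval.disjWithin a b :=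
    eventually_inf_principal.mpr (by simp)
  filter_upwards [hE] with E hE
  exact Finset.sum_le_sum fun i hi => h _ (hE.1 i hi).1 _ (hE.1 i hi).2

/-- W differs by a constant from the integral of its derivative. Absolute continuity is the
regularity required for integration by parts, because rates are merely integrable in time. -/
theorem absolutelyContinuousOnInterval_of_hasDerivAt {W W' : ℝ → ℝ} {a b : ℝ}
    (hab : a ≤ b) (hW : ∀ t ∈ Icc a b, HasDerivAt W (W' t) t) (hW' : ContinuousOn W' (Icc a b)) :
    AbsolutelyContinuousOnInterval W a b := by
  have hint : IntervalIntegrable W' volume a b := by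
    apply ContinuousOn.intervalIntegrable
    rwa [uIcc_of_le hab]
  refine (hint.absolutelyContinuousOnInterval_intervalIntegral (c := a) (by simp)).of_dist_le ?_
  have key : ∀ x ∈ uIcc a b, ∫ v in a..x, W' v = W x - W a := by
    intro x hx
    rw [uIcc_of_le hab] at hx
    have hsub : uIcc a x ⊆ Icc a b := by
      rw [uIcc_of_le hx.1]; exact Icc_subset_Icc le_rfl hx.2
    exact intervalIntegral.integral_eq_sub_of_hasDerivAt (fun t ht => hW t (hsub ht))
      (ContinuousOn.intervalIntegrable (hW'.mono hsub))
  intro x hx y hy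
  rw [key x hx, key y hy, dist_sub_right]

/-- Integration by parts against the survival function `exp (-∫ l)` of the hazard rate `l`. -/
theorem integral_mul_survival {l W W' : ℝ → ℝ} {a b : ℝ} (hab : a ≤ b) (hl0 : ∀ t, 0 ≤ l t)
    (hl : IntervalIntegrable l volume a b) (hW : ∀ t ∈ Icc a b, HasDerivAt W (W' t) t)
    (hW' : ContinuousOn W' (Icc a b)) :
    IntervalIntegrable (fun t => (-W' t + W t * l t) * Real.exp (-∫ s in a..t, l s)) volume a b ∧
    ∫ t in a..b, (-W' t + W t * l t) * Real.exp (-∫ s in a..t, l s) =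
      W a - W b * Real.exp (-∫ s in a..b, l s) := by
  have hH := hl.absolutelyContinuousOnInterval_intervalIntegral (c := a) (by simp)
  have hHnn : ∀ x ∈ uIcc a b, 0 ≤ ∫ s in a..x, l s := by
    intro x hx
    rw [uIcc_of_le hab] at hx
    exact intervalIntegral.integral_nonneg hx.1 fun t _ => hl0 t
  have hE : AbsolutelyContinuousOnInterval (fun t => Real.exp (-∫ s in a..t, l s)) a b := by
    refine hH.of_dist_le fun x hx y hy => ?_
    -- exp(-x) is 1-Lipschitz on [0, ∞), so the survival function inherits absolute continuity from
    -- the integrated hazard.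
    have aux : ∀ u v : ℝ, 0 ≤ u → u ≤ v → |Real.exp (-u) - Real.exp (-v)| ≤ |u - v| := by
      intro u v hu huv
      have h1 : Real.exp (-v) ≤ Real.exp (-u) := Real.exp_le_exp.2 (by linarith)
      have h2 : Real.exp (-v) = Real.exp (-u) * Real.exp (u - v) := by
        rw [← Real.exp_add]; ring_nf
      have h3 := Real.add_one_le_exp (u - v)
      have h4 : Real.exp (-u) ≤ 1 := Real.exp_le_one_iff.2 (by linarith)
      have h5 := Real.exp_pos (-u)
      rw [abs_of_nonneg (by linarith), abs_of_nonpos (by linarith), h2]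
      nlinarith
    rw [Real.dist_eq, Real.dist_eq]
    rcases le_total (∫ s in a..x, l s) (∫ s in a..y, l s) with h | h
    · exact aux _ _ (hHnn x hx) h
    · rw [abs_sub_comm, abs_sub_comm (∫ s in a..x, l s)]
      exact aux _ _ (hHnn y hy) h
  have hWac := absolutelyContinuousOnInterval_of_hasDerivAt hab hW hW'
  have hparts := hWac.integral_deriv_mul_eq_sub hE
  have hint : IntervalIntegrable (fun t => (-W' t + W t * l t) * Real.exp (-∫ s in a..t, l s))
      volume a b := by
    refine IntervalIntegrable.mul_continuousOn ?_ hE.continuousOn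
    refine IntervalIntegrable.add ?_ (hl.continuousOn_mul hWac.continuousOn)
    apply ContinuousOn.intervalIntegrable
    rw [uIcc_of_le hab]
    exact hW'.neg
  refine ⟨hint, ?_⟩
  rw [intervalIntegral.integral_same, neg_zero, Real.exp_zero, mul_one] at hparts
  rw [← neg_inj, neg_sub, ← hparts, ← intervalIntegral.integral_neg]
  apply intervalIntegral.integral_congr_ae
  filter_upwards [hl.ae_hasDerivAt_integral] with t ht hmem
  have hmem' : t ∈ uIcc a b := uIoc_subset_uIcc hmem
  have h1 := (ht hmem' a (by simp)).neg.exp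
  have hmem'' : t ∈ Icc a b := by rwa [uIcc_of_le hab] at hmem'
  rw [(hW t hmem'').deriv]
  have h2 : deriv (fun t => Real.exp (-∫ s in a..t, l s)) t =
      Real.exp (-∫ s in a..t, l s) * -l t := h1.deriv
  rw [h2]
  ring

variable {l : ℝ → ℝ} {a : ℝ}

theorem continuousOn_primitive_Ici (hl : ∀ t, a ≤ t → IntervalIntegrable l volume a t) :
    ContinuousOn (fun t => ∫ s in a..t, l s) (Ici a) := by
  intro t ht
  have h1 : ContinuousOn (fun t => ∫ s in a..t, l s) (uIcc a (t + 1)) :=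
    intervalIntegral.continuousOn_primitive_interval' (hl (t + 1) (le_trans ht (by linarith)))
      (by simp)
  have ht' : a ≤ t := ht
  rw [uIcc_of_le (by linarith)] at h1
  refine (h1 t ⟨ht, by linarith⟩).mono_of_mem_nhdsWithin ?_
  filter_upwards [self_mem_nhdsWithin, mem_nhdsWithin_of_mem_nhds (Iio_mem_nhds (lt_add_one t))]
    with x hx hx'
  exact ⟨hx, le_of_lt hx'⟩

theorem primitive_mono_Ici (hl0 : ∀ t, 0 ≤ l t)
    (hl : ∀ t, a ≤ t → IntervalIntegrable l volume a t) {s t : ℝ} (hs : a ≤ s) (hst : s ≤ t) :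
    ∫ s in a..s, l s ≤ ∫ s in a..t, l s :=
  intervalIntegral.integral_mono_interval le_rfl hs hst
    (Eventually.of_forall fun x => hl0 x) (hl t (hs.trans hst))

/-- The first time at which the integrated rate reaches the level `e`. -/
theorem hitting_le_iff (hl0 : ∀ t, 0 ≤ l t) (hl : ∀ t, a ≤ t → IntervalIntegrable l volume a t)
    (hunb : ∀ e, ∃ t, a ≤ t ∧ e ≤ ∫ s in a..t, l s) (e t : ℝ) :
    sInf {t | a ≤ t ∧ e ≤ ∫ s in a..t, l s} ≤ t ↔ a ≤ t ∧ e ≤ ∫ s in a..t, l s := by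
  set S := {t | a ≤ t ∧ e ≤ ∫ s in a..t, l s} with hS
  have hbdd : BddBelow S := ⟨a, fun t ht => ht.1⟩
  have hclosed : IsClosed S := by
    have := (continuousOn_primitive_Ici hl).preimage_isClosed_of_isClosed isClosed_Ici
      (isClosed_Ici (a := e))
    exact this
  have hmem : sInf S ∈ S := hclosed.csInf_mem (hunb e) hbdd
  constructor
  · intro h
    exact ⟨hmem.1.trans h, hmem.2.trans (primitive_mono_Ici hl0 hl hmem.1 h)⟩
  · intro h
    exact csInf_le hbdd h

theorem le_hitting (hunb : ∀ e, ∃ t, a ≤ t ∧ e ≤ ∫ s in a..t, l s) (e : ℝ) :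
    a ≤ sInf {t | a ≤ t ∧ e ≤ ∫ s in a..t, l s} :=
  le_csInf (hunb e) fun _ ht => ht.1

/-- The law of the hitting time for an exponential clock has hazard rate `l`. -/
theorem lintegral_hitting (hm : Measurable l) (hl0 : ∀ t, 0 ≤ l t)
    (hl : ∀ t, a ≤ t → IntervalIntegrable l volume a t)
    (hunb : ∀ e, ∃ t, a ≤ t ∧ e ≤ ∫ s in a..t, l s) {G : ℝ → ENNReal} (hG : Measurable G) :
    ∫⁻ e, G (sInf {t | a ≤ t ∧ e ≤ ∫ s in a..t, l s}) ∂(expMeasure 1) =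
      ∫⁻ t in Ioi a, ENNReal.ofReal (l t * Real.exp (-∫ s in a..t, l s)) * G t := by
  have hprob : IsProbabilityMeasure (expMeasure 1) := isProbabilityMeasure_expMeasure one_pos
  have hiff := hitting_le_iff hl0 hl hunb
  set N : ℝ → ℝ := fun e => sInf {t | a ≤ t ∧ e ≤ ∫ s in a..t, l s} with hN
  have hNm : Measurable N := by
    refine measurable_of_Iic fun t => ?_
    by_cases h : a ≤ t
    · have : N ⁻¹' Iic t = Iic (∫ s in a..t, l s) := by
        ext e; simp only [mem_preimage, mem_Iic, hN, hiff, h, true_and]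
      rw [this]; exact measurableSet_Iic
    · have : N ⁻¹' Iic t = ∅ := by
        ext e; simp only [mem_preimage, mem_Iic, hN, hiff, h, false_and, mem_empty_iff_false]
      rw [this]; exact MeasurableSet.empty
  have hdens : AEMeasurable (fun t => ENNReal.ofReal (l t * Real.exp (-∫ s in a..t, l s)))
      (volume.restrict (Ioi a)) := by
    refine ENNReal.measurable_ofReal.comp_aemeasurable (hm.aemeasurable.mul ?_)
    refine Real.measurable_exp.comp_aemeasurable (AEMeasurable.neg ?_)
    exact ((continuousOn_primitive_Ici hl).mono Ioi_subset_Ici_self).aemeasurable measurableSet_Ioi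
  -- Both measures are compared on half-lines; `integral_mul_survival` with W = 1 computes the
  -- integral of the density.
  have hlaw : (expMeasure 1).map N = (volume.restrict (Ioi a)).withDensity
      (fun t => ENNReal.ofReal (l t * Real.exp (-∫ s in a..t, l s))) := by
    have := Measure.isProbabilityMeasure_map (μ := expMeasure 1) hNm.aemeasurable
    refine Measure.ext_of_Iic _ _ fun t => ?_
    rw [Measure.map_apply hNm measurableSet_Iic, withDensity_apply _ measurableSet_Iic,
      Measure.restrict_restrict measurableSet_Iic, inter_comm, Ioi_inter_Iic]
    by_cases h : a ≤ t
    · have h1 : N ⁻¹' Iic t = Iic (∫ s in a..t, l s) := by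
        ext e; simp only [mem_preimage, mem_Iic, hN, hiff, h, true_and]
      have hnn : 0 ≤ ∫ s in a..t, l s := intervalIntegral.integral_nonneg h fun t _ => hl0 t
      have h2 : (expMeasure 1) (Iic (∫ s in a..t, l s)) =
          ENNReal.ofReal (1 - Real.exp (-∫ s in a..t, l s)) := by
        rw [← ofReal_cdf, cdf_expMeasure_eq one_pos, if_pos hnn, one_mul]
      have h3 := integral_mul_survival (W := fun _ => 1) (W' := fun _ => 0) h hl0 (hl t h)
        (fun t _ => hasDerivAt_const t (1 : ℝ)) continuousOn_const
      simp only [neg_zero, zero_add, one_mul] at h3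
      rw [h1, h2, ← h3.2, intervalIntegral.integral_of_le h,
        ofReal_integral_eq_lintegral_ofReal]
      · exact (intervalIntegrable_iff_integrableOn_Ioc_of_le h).1 h3.1
      · exact Eventually.of_forall fun t => mul_nonneg (hl0 t) (Real.exp_pos _).le
    · have h1 : N ⁻¹' Iic t = ∅ := by
        ext e; simp only [mem_preimage, mem_Iic, hN, hiff, h, false_and, mem_empty_iff_false]
      rw [h1, Ioc_eq_empty (fun h' => h h'.le)]
      simp
  rw [← lintegral_map (f := G) hG hNm, hlaw, lintegral_withDensity_eq_lintegral_mul₀ hdens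
    hG.aemeasurable]
  rfl

end HittingTime

namespace Bass
-- Arrival times: measurability and resampling of a clock.
section Arrivals

open Set Filter Topology

/-- The adoption rate at price `0` when `n` customers have arrived. -/
noncomputable def baseRate (m : ℕ) (α β : ℝ) (n : ℕ) : ℝ := rate m α β 0 ((n : ℝ) / m)

theorem rate_eq_mul_exp (m : ℕ) (α β p : ℝ) (n : ℕ) :
    rate m α β p ((n : ℝ) / m) = baseRate m α β n * Real.exp (-p) := by
  simp only [baseRate, rate, neg_zero, Real.exp_zero]; ring

theorem baseRate_eq {m : ℕ} (hm : 0 < m) (α β : ℝ) (n : ℕ) :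
    baseRate m α β n = (α + β * (n / m)) * (m - n) := by
  have : (m : ℝ) ≠ 0 := by positivity
  simp only [baseRate, rate, neg_zero, Real.exp_zero]
  field_simp

variable {m : ℕ} {α β T : ℝ}

theorem baseRate_pos (hα : 0 < α) (hβ : 0 ≤ β) {n : ℕ} (hn : n < m) :
    0 < baseRate m α β n := by
  rw [baseRate_eq (by omega)]
  have h : (n : ℝ) < m := by exact_mod_cast hn
  have : 0 < α + β * (n / m) := by positivity
  exact mul_pos this (by linarith)

/-- The rate of the next arrival after a given history. -/
noncomputable def Policy.hazard (m : ℕ) (α β : ℝ) (π : Policy T) (u : unitInterval) (n : ℕ)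
    (h : Fin n → ℝ) (t : ℝ) : ℝ :=
  rate m α β (π.posted n u h t) ((n : ℝ) / m)

theorem Policy.measurable_posted (π : Policy T) (n : ℕ) :
    Measurable (fun z : unitInterval × (Fin n → ℝ) × ℝ => π.posted n z.1 z.2.1 z.2.2) := by
  unfold Policy.posted
  exact Measurable.ite (measurableSet_le (by fun_prop) measurable_const) (π.measurable n)
    measurable_const

theorem Policy.measurable_hazard (π : Policy T) (n : ℕ) :
    Measurable (fun z : unitInterval × (Fin n → ℝ) × ℝ =>
      π.hazard m α β z.1 n z.2.1 z.2.2) := by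
  unfold Policy.hazard
  simp only [rate_eq_mul_exp]
  have := π.measurable_posted n
  fun_prop

theorem Policy.hazard_nonneg (hα : 0 < α) (hβ : 0 ≤ β) (π : Policy T) (u : unitInterval) {n : ℕ}
    (hn : n < m) (h : Fin n → ℝ) (t : ℝ) : 0 ≤ π.hazard m α β u n h t := by
  rw [Policy.hazard, rate_eq_mul_exp]
  exact mul_nonneg (baseRate_pos hα hβ hn).le (Real.exp_pos _).le

theorem Policy.intervalIntegrable_hazard (hT : 0 ≤ T) (π : Policy T) (u : unitInterval) (n : ℕ)
    (h : Fin n → ℝ) {a t : ℝ} (ha : 0 ≤ a) (hat : a ≤ t) :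
    IntervalIntegrable (π.hazard m α β u n h) volume a t := by
  have h1 : IntervalIntegrable (π.hazard m α β u n h) volume 0 T := by
    refine ((π.integrable n u h).const_mul (baseRate m α β n)).congr fun s hs => ?_
    rw [uIoc_of_le hT] at hs
    simp only [Policy.hazard, rate_eq_mul_exp, Policy.posted, if_pos hs.2]
  have h2 : IntervalIntegrable (π.hazard m α β u n h) volume T (max T t) := by
    refine (intervalIntegrable_const (c := baseRate m α β n)).congr fun s hs => ?_
    rw [uIoc_of_le (le_max_left _ _)] at hs
    simp only [Policy.hazard, rate_eq_mul_exp, Policy.posted, if_neg (not_le.2 hs.1), neg_zero,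
      Real.exp_zero, mul_one]
  refine (h1.trans h2).mono_set ?_
  rw [uIcc_of_le hat, uIcc_of_le (hT.trans (le_max_left _ _))]
  exact Icc_subset_Icc ha (le_max_right _ _)

/-- After the horizon the price is 0 and the rate is a positive constant, so every level is reached.
This keeps the infimum in `nextArrival` away from the empty set. -/
theorem Policy.exists_le_integral_hazard (hα : 0 < α) (hβ : 0 ≤ β) (hT : 0 ≤ T) (π : Policy T)
    (u : unitInterval) {n : ℕ} (hn : n < m) (h : Fin n → ℝ) {a : ℝ} (ha : 0 ≤ a) (e : ℝ) :
    ∃ t, a ≤ t ∧ e ≤ ∫ s in a..t, π.hazard m α β u n h s := by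
  have hq := baseRate_pos hα hβ hn
  set c := max a T
  have hac : a ≤ c := le_max_left _ _
  have hTc : T ≤ c := le_max_right _ _
  have hd : 0 ≤ |e| / baseRate m α β n := by positivity
  refine ⟨c + |e| / baseRate m α β n, by linarith, ?_⟩
  have hI := fun {a t : ℝ} (ha : 0 ≤ a) (hat : a ≤ t) =>
    π.intervalIntegrable_hazard (m := m) (α := α) (β := β) hT u n h ha hat
  rw [← intervalIntegral.integral_add_adjacent_intervals (hI ha hac)
    (hI (ha.trans hac) (by linarith : c ≤ c + |e| / baseRate m α β n))]
  have h1 : 0 ≤ ∫ s in a..c, π.hazard m α β u n h s :=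
    intervalIntegral.integral_nonneg hac fun s _ => π.hazard_nonneg hα hβ u hn h s
  have h2 : ∫ s in c..(c + |e| / baseRate m α β n), π.hazard m α β u n h s = |e| := by
    have : ∫ s in c..(c + |e| / baseRate m α β n), π.hazard m α β u n h s =
        ∫ s in c..(c + |e| / baseRate m α β n), baseRate m α β n := by
      apply intervalIntegral.integral_congr_ae
      refine Eventually.of_forall fun s hs => ?_
      rw [uIoc_of_le (by linarith)] at hs
      simp only [Policy.hazard, rate_eq_mul_exp, Policy.posted,
        if_neg (not_le.2 (hTc.trans_lt hs.1)), neg_zero, Real.exp_zero, mul_one]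
    rw [this, intervalIntegral.integral_const, smul_eq_mul, add_sub_cancel_left]
    field_simp
  rw [h2]
  linarith [le_abs_self e]

theorem nextArrival_le_iff (hα : 0 < α) (hβ : 0 ≤ β) (hT : 0 ≤ T) (π : Policy T)
    (u : unitInterval) {n : ℕ} (hn : n < m) {h : Fin n → ℝ} (ha : 0 ≤ lastTime n h) (e t : ℝ) :
    nextArrival m α β π u n h e ≤ t ↔
      lastTime n h ≤ t ∧ e ≤ ∫ s in lastTime n h..t, π.hazard m α β u n h s :=
  hitting_le_iff (fun s => π.hazard_nonneg hα hβ u hn h s)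
    (fun _ ht => π.intervalIntegrable_hazard hT u n h ha ht)
    (π.exists_le_integral_hazard hα hβ hT u hn h ha) e t

theorem lastTime_le_nextArrival (hα : 0 < α) (hβ : 0 ≤ β) (hT : 0 ≤ T) (π : Policy T)
    (u : unitInterval) {n : ℕ} (hn : n < m) {h : Fin n → ℝ} (ha : 0 ≤ lastTime n h) (e : ℝ) :
    lastTime n h ≤ nextArrival m α β π u n h e :=
  le_hitting (π.exists_le_integral_hazard hα hβ hT u hn h ha) e

theorem lastTime_arrivals_succ (π : Policy T) (ω : Sample) (n : ℕ) :
    lastTime (n + 1) (arrivals m α β π ω (n + 1)) = arrivalTime m α β π ω n := by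
  simp [lastTime, arrivals, arrivalTime]

theorem lastTime_arrivals_nonneg (hα : 0 < α) (hβ : 0 ≤ β) (hT : 0 ≤ T) (π : Policy T)
    (ω : Sample) : ∀ {n : ℕ}, n ≤ m → 0 ≤ lastTime n (arrivals m α β π ω n)
  | 0, _ => le_rfl
  | n + 1, hn => by
    rw [lastTime_arrivals_succ]
    have h := lastTime_arrivals_nonneg hα hβ hT π ω (n := n) (by omega)
    exact h.trans (lastTime_le_nextArrival hα hβ hT π ω.1 (by omega) h _)

theorem lastTime_le_arrivalTime (hα : 0 < α) (hβ : 0 ≤ β) (hT : 0 ≤ T) (π : Policy T)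
    (ω : Sample) {n : ℕ} (hn : n < m) :
    lastTime n (arrivals m α β π ω n) ≤ arrivalTime m α β π ω n :=
  lastTime_le_nextArrival hα hβ hT π ω.1 hn (lastTime_arrivals_nonneg hα hβ hT π ω hn.le) _

theorem arrivals_congr (π : Policy T) (u : unitInterval) {x y : ℕ → ℝ} :
    ∀ {n : ℕ}, (∀ i < n, x i = y i) → arrivals m α β π (u, x) n = arrivals m α β π (u, y) n
  | 0, _ => rfl
  | n + 1, h => by
    simp only [arrivals]
    rw [arrivals_congr π u (n := n) fun i hi => h i (by omega), h n (by omega)]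

/-- The first n arrivals use only the clocks with index below n. This is the form in which
independence of the next clock from the past is used. -/
theorem arrivals_update (π : Policy T) (u : unitInterval) (x : ℕ → ℝ) (n : ℕ) (e : ℝ) :
    arrivals m α β π (u, Function.update x n e) n = arrivals m α β π (u, x) n :=
  arrivals_congr π u fun _ hi => Function.update_of_ne (by omega) _ _

theorem measurable_lastTime : ∀ n, Measurable (lastTime n)
  | 0 => measurable_const
  | n + 1 => measurable_pi_apply (Fin.last n)

theorem measurable_arrivalTime_of_arrivals (hα : 0 < α) (hβ : 0 ≤ β) (hT : 0 ≤ T) (π : Policy T)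
    {n : ℕ} (hn : n < m) (harr : Measurable fun ω => arrivals m α β π ω n) :
    Measurable fun ω => arrivalTime m α β π ω n := by
  refine measurable_of_Iic fun t => ?_
  have hlast : Measurable fun ω => lastTime n (arrivals m α β π ω n) :=
    (measurable_lastTime n).comp harr
  -- The random lower limit is moved into an indicator, so that measurability in ω follows from
  -- joint measurability of the integrand.
  let I : Sample → ℝ := fun ω => ∫ s, if lastTime n (arrivals m α β π ω n) < s ∧ s ≤ t then
    π.hazard m α β ω.1 n (arrivals m α β π ω n) s else 0
  have hI : Measurable I := by
    refine StronglyMeasurable.measurable ?_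
    refine StronglyMeasurable.integral_prod_right (f := fun (ω : Sample) (s : ℝ) =>
      if lastTime n (arrivals m α β π ω n) < s ∧ s ≤ t then
        π.hazard m α β ω.1 n (arrivals m α β π ω n) s else 0) ?_
    refine Measurable.stronglyMeasurable ?_
    refine Measurable.ite ?_ ?_ measurable_const
    · exact (measurableSet_lt (hlast.comp measurable_fst) measurable_snd).inter
        (measurableSet_le measurable_snd measurable_const)
    · exact (π.measurable_hazard (m := m) (α := α) (β := β) n).comp
        (f := fun z : Sample × ℝ => (z.1.1, arrivals m α β π z.1 n, z.2))
        ((measurable_fst.comp measurable_fst).prodMk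
          ((harr.comp measurable_fst).prodMk measurable_snd))
  have hset : (fun ω => arrivalTime m α β π ω n) ⁻¹' Iic t =
      {ω | lastTime n (arrivals m α β π ω n) ≤ t} ∩ {ω | ω.2 n ≤ I ω} := by
    ext ω
    rw [mem_preimage, mem_Iic, arrivalTime, nextArrival_le_iff hα hβ hT π ω.1 hn
      (lastTime_arrivals_nonneg hα hβ hT π ω hn.le)]
    refine and_congr_right fun h => ?_
    have : I ω = ∫ s in lastTime n (arrivals m α β π ω n)..t,
        π.hazard m α β ω.1 n (arrivals m α β π ω n) s := by
      rw [intervalIntegral.integral_of_le h, ← integral_indicator measurableSet_Ioc]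
      simp only [I, indicator_apply, mem_Ioc]
    rw [mem_ofPred_eq, this]
  rw [hset]
  exact (measurableSet_le hlast measurable_const).inter
    (measurableSet_le ((measurable_pi_apply n).comp measurable_snd) hI)

theorem measurable_arrivals (hα : 0 < α) (hβ : 0 ≤ β) (hT : 0 ≤ T) (π : Policy T) :
    ∀ {n : ℕ}, n ≤ m → Measurable fun ω => arrivals m α β π ω n
  | 0, _ => measurable_const
  | n + 1, hn => by
    have h1 := measurable_arrivals hα hβ hT π (n := n) (by omega)
    have h2 := measurable_arrivalTime_of_arrivals hα hβ hT π (by omega) h1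
    refine measurable_pi_iff.2 fun i => ?_
    refine Fin.lastCases ?_ (fun j => ?_) i
    · simpa only [arrivals, Fin.snoc_last] using! h2
    · simpa only [arrivals, Fin.snoc_castSucc] using! (measurable_pi_apply j).comp h1

theorem measurable_arrivalTime (hα : 0 < α) (hβ : 0 ≤ β) (hT : 0 ≤ T) (π : Policy T)
    {n : ℕ} (hn : n < m) : Measurable fun ω => arrivalTime m α β π ω n :=
  measurable_arrivalTime_of_arrivals hα hβ hT π hn (measurable_arrivals hα hβ hT π hn.le)

instance instIsProbabilityMeasureSample : IsProbabilityMeasure sampleMeasure := by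
  unfold sampleMeasure; infer_instance

/-- Resampling one coordinate of a product measure does not change the measure. -/
theorem measurePreserving_update_infinitePi {X : ℕ → Type*} [∀ i, MeasurableSpace (X i)]
    (μ : ∀ i, Measure (X i)) [∀ i, IsProbabilityMeasure (μ i)] (n : ℕ) :
    MeasurePreserving (fun z : (∀ i, X i) × X n => Function.update z.1 n z.2)
      ((Measure.infinitePi μ).prod (μ n)) (Measure.infinitePi μ) := by
  have hmeas : Measurable (fun z : (∀ i, X i) × X n => Function.update z.1 n z.2) :=
    measurable_update'
  refine ⟨hmeas, Measure.eq_infinitePi _ fun s t ht => ?_⟩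
  rw [Measure.map_apply hmeas (MeasurableSet.pi s.countable_toSet fun i _ => ht i)]
  by_cases hn : n ∈ s
  · have : (fun z : (∀ i, X i) × X n => Function.update z.1 n z.2) ⁻¹' (s : Set ℕ).pi t =
        ((s.erase n : Finset ℕ) : Set ℕ).pi t ×ˢ t n := by
      ext ⟨x, e⟩
      simp only [mem_preimage, Set.mem_pi, mem_prod, Finset.mem_coe, Finset.mem_erase]
      constructor
      · intro h
        refine ⟨fun i hi => ?_, ?_⟩
        · simpa [Function.update_of_ne hi.1] using h i hi.2
        · simpa using h n hn
      · rintro ⟨h1, h2⟩ i hi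
        by_cases hin : i = n
        · subst hin; simpa using h2
        · simpa [Function.update_of_ne hin] using h1 i ⟨hin, hi⟩
    rw [this, Measure.prod_prod, Measure.infinitePi_pi _ (fun i _ => ht i), mul_comm,
      Finset.mul_prod_erase s (fun i => μ i (t i)) hn]
  · have : (fun z : (∀ i, X i) × X n => Function.update z.1 n z.2) ⁻¹' (s : Set ℕ).pi t =
        (s : Set ℕ).pi t ×ˢ univ := by
      ext ⟨x, e⟩
      simp only [mem_preimage, Set.mem_pi, mem_prod, Finset.mem_coe, mem_univ, and_true]
      refine forall₂_congr fun i hi => ?_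
      rw [Function.update_of_ne fun h : i = n => hn (h ▸ hi)]
    rw [this, Measure.prod_prod, measure_univ, mul_one, Measure.infinitePi_pi _ fun i _ => ht i]

/-- Integrating out a fresh n-th clock first replaces conditioning on the history. -/
theorem lintegral_sample_update {Z : Sample → ENNReal} (hZ : Measurable Z) (n : ℕ) :
    ∫⁻ ω, Z ω ∂sampleMeasure =
      ∫⁻ ω, ∫⁻ e, Z (ω.1, Function.update ω.2 n e) ∂(expMeasure 1) ∂sampleMeasure := by
  have hupd : Measurable fun z : Sample × ℝ => Z (z.1.1, Function.update z.1.2 n z.2) := by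
    refine hZ.comp ((measurable_fst.comp measurable_fst).prodMk ?_)
    exact (measurable_update' (a := n)).comp
      (f := fun z : Sample × ℝ => ((z.1.2, z.2) : (ℕ → ℝ) × ℝ))
      ((measurable_snd.comp measurable_fst).prodMk measurable_snd)
  have hmp := measurePreserving_update_infinitePi (fun _ : ℕ => expMeasure 1) n
  have hinner : Measurable fun ω : Sample =>
      ∫⁻ e, Z (ω.1, Function.update ω.2 n e) ∂(expMeasure 1) := hupd.lintegral_prod_right'
  rw [sampleMeasure, lintegral_prod _ hZ.aemeasurable, lintegral_prod _ hinner.aemeasurable]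
  refine lintegral_congr fun u => ?_
  rw [← hmp.lintegral_comp (f := fun x => Z (u, x)) (hZ.comp measurable_prodMk_left),
    lintegral_prod]
  exact (hZ.comp (measurable_prodMk_left.comp hmp.measurable)).aemeasurable

end Arrivals
-- Verification theorem for the stochastic control problem.
section Verification

open Set Filter Topology

/-- A family of differentiable functions of time, indexed by the number of arrivals, which
decrease to `0` at the horizon: candidates for the value function of the stochastic model. -/
structure IsPotential (m : ℕ) (T : ℝ) (W W' : ℕ → ℝ → ℝ) : Prop where
  measurable : ∀ n ≤ m, Measurable (W n)
  measurable_deriv : ∀ n ≤ m, Measurable (W' n)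
  hasDerivAt : ∀ n ≤ m, ∀ t ∈ Icc 0 T, HasDerivAt (W n) (W' n t) t
  continuousOn : ∀ n ≤ m, ContinuousOn (W' n) (Icc 0 T)
  terminal : ∀ n ≤ m, W n T = 0
  deriv_nonpos : ∀ n ≤ m, ∀ t ∈ Icc 0 T, W' n t ≤ 0

variable {m : ℕ} {α β T : ℝ} {W W' : ℕ → ℝ → ℝ}

theorem IsPotential.antitoneOn (hW : IsPotential m T W W') {n : ℕ} (hn : n ≤ m) :
    AntitoneOn (W n) (Icc 0 T) := by
  refine antitoneOn_of_deriv_nonpos (convex_Icc 0 T)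
    (fun t ht => (hW.hasDerivAt n hn t ht).continuousAt.continuousWithinAt)
    (fun t ht => (hW.hasDerivAt n hn t
      (interior_subset ht)).differentiableAt.differentiableWithinAt) fun t ht => ?_
  rw [(hW.hasDerivAt n hn t (interior_subset ht)).deriv]
  exact hW.deriv_nonpos n hn t (interior_subset ht)

theorem IsPotential.nonneg (hW : IsPotential m T W W') {n : ℕ} (hn : n ≤ m) {t : ℝ}
    (ht : t ∈ Icc 0 T) : 0 ≤ W n t := by
  rw [← hW.terminal n hn]
  exact hW.antitoneOn hn ht ⟨ht.1.trans ht.2, le_rfl⟩ ht.2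

theorem IsPotential.le_initial (hW : IsPotential m T W W') {n : ℕ} (hn : n ≤ m) {t : ℝ}
    (ht : t ∈ Icc 0 T) : W n t ≤ W n 0 :=
  hW.antitoneOn hn ⟨le_rfl, ht.1.trans ht.2⟩ ht ht.1

/-- The compensated gain of the next arrival at time `t`. -/
noncomputable def gainAt (m : ℕ) (α β : ℝ) (W W' : ℕ → ℝ → ℝ) (π : Policy T) (u : unitInterval)
    (n : ℕ) (h : Fin n → ℝ) (t : ℝ) : ℝ :=
  if t ≤ T then -W' n t * Real.exp (π.price n u h t) / baseRate m α β n + W n t else 0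

/-- The gain charges the running decay of W to the arrival itself: times the arrival density it
becomes the integrand of `integral_mul_survival`, and the terminal value 0 leaves only W at the last
arrival. -/
theorem lintegral_gainAt (hα : 0 < α) (hβ : 0 ≤ β) (hT : 0 ≤ T) (hW : IsPotential m T W W')
    (π : Policy T) (u : unitInterval) {n : ℕ} (hn : n < m) {h : Fin n → ℝ}
    (ha : 0 ≤ lastTime n h) :
    ∫⁻ e, ENNReal.ofReal (gainAt m α β W W' π u n h (nextArrival m α β π u n h e))
      ∂(expMeasure 1) =
      ENNReal.ofReal (if lastTime n h ≤ T then W n (lastTime n h) else 0) := by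
  have hq := baseRate_pos hα hβ hn
  set a := lastTime n h with hadef
  set l := π.hazard m α β u n h with hldef
  have hl0 : ∀ t, 0 ≤ l t := fun t => π.hazard_nonneg hα hβ u hn h t
  have hI : ∀ t, a ≤ t → IntervalIntegrable l volume a t := fun t ht =>
    π.intervalIntegrable_hazard hT u n h ha ht
  have hlm : Measurable l :=
    (π.measurable_hazard (m := m) (α := α) (β := β) n).comp
      (f := fun t : ℝ => (u, h, t)) (by fun_prop)
  have hpm : Measurable (π.price n u h) :=
    (π.measurable n).comp (f := fun t : ℝ => (u, h, t)) (by fun_prop)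
  have hG : Measurable fun t => ENNReal.ofReal (gainAt m α β W W' π u n h t) := by
    unfold gainAt
    refine ENNReal.measurable_ofReal.comp (Measurable.ite measurableSet_Iic ?_ measurable_const)
    exact (((hW.measurable_deriv n hn.le).neg.mul (Real.measurable_exp.comp hpm)).div_const _).add
      (hW.measurable n hn.le)
  have key := lintegral_hitting hlm hl0 hI (π.exists_le_integral_hazard hα hβ hT u hn h ha) hG
  refine key.trans ?_
  by_cases haT : a ≤ T
  · rw [if_pos haT]
    have hsub : Icc a T ⊆ Icc 0 T := Icc_subset_Icc ha le_rfl
    obtain ⟨h1, h2⟩ := integral_mul_survival haT hl0 (hI T haT)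
      (fun t ht => hW.hasDerivAt n hn.le t (hsub ht)) ((hW.continuousOn n hn.le).mono hsub)
    rw [hW.terminal n hn.le, zero_mul, sub_zero] at h2
    have h3 : ∀ t ∈ Icc a T, 0 ≤ (-W' n t + W n t * l t) * Real.exp (-∫ s in a..t, l s) := by
      intro t ht
      have := hW.deriv_nonpos n hn.le t (hsub ht)
      have := mul_nonneg (hW.nonneg hn.le (hsub ht)) (hl0 t)
      exact mul_nonneg (by linarith) (Real.exp_pos _).le
    have h4 : ∫⁻ t in Ioc a T, ENNReal.ofReal
        ((-W' n t + W n t * l t) * Real.exp (-∫ s in a..t, l s)) = ENNReal.ofReal (W n a) := by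
      rw [← h2, intervalIntegral.integral_of_le haT, ofReal_integral_eq_lintegral_ofReal]
      · exact (intervalIntegrable_iff_integrableOn_Ioc_of_le haT).1 h1
      · exact (ae_restrict_iff' measurableSet_Ioc).2
          (Eventually.of_forall fun t ht => h3 t (Ioc_subset_Icc_self ht))
    rw [← h4, ← Ioi_inter_Iic, inter_comm, ← Measure.restrict_restrict measurableSet_Iic,
      ← lintegral_indicator measurableSet_Iic]
    refine lintegral_congr fun t => ?_
    by_cases ht : t ≤ T
    · rw [indicator_of_mem (show t ∈ Iic T from ht),
        ← ENNReal.ofReal_mul (mul_nonneg (hl0 t) (Real.exp_pos _).le), gainAt, if_pos ht]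
      congr 1
      have hlt : l t = baseRate m α β n * Real.exp (-π.price n u h t) := by
        rw [hldef, Policy.hazard, rate_eq_mul_exp, Policy.posted, if_pos ht]
      have hee : Real.exp (-π.price n u h t) * Real.exp (π.price n u h t) = 1 := by
        rw [← Real.exp_add]; simp
      -- The factor exp(p)/q in the gain is the reciprocal of the hazard rate.
      have h5 : l t * (Real.exp (π.price n u h t) / baseRate m α β n) = 1 := by
        rw [hlt]; field_simp; linarith
      linear_combination (-W' n t * Real.exp (-∫ s in a..t, l s)) * h5
    · rw [indicator_of_notMem (show t ∉ Iic T from ht), gainAt, if_neg ht]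
      simp
  · rw [if_neg haT, ENNReal.ofReal_zero, lintegral_eq_zero_iff' ]
    · refine (ae_restrict_iff' measurableSet_Ioi).2 (Eventually.of_forall fun t ht => ?_)
      have : ¬ t ≤ T := fun h => haT ((le_of_lt ht).trans h)
      simp [gainAt, if_neg this]
    · refine AEMeasurable.mul ?_ hG.aemeasurable
      refine ENNReal.measurable_ofReal.comp_aemeasurable (hlm.aemeasurable.mul ?_)
      refine Real.measurable_exp.comp_aemeasurable (AEMeasurable.neg ?_)
      exact ((continuousOn_primitive_Ici hI).mono Ioi_subset_Ici_self).aemeasurable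
        measurableSet_Ioi

/-- The gain of customer `n + 1`. -/
noncomputable def gain (m : ℕ) (α β : ℝ) (W W' : ℕ → ℝ → ℝ) (π : Policy T) (n : ℕ)
    (ω : Sample) : ℝ :=
  gainAt m α β W W' π ω.1 n (arrivals m α β π ω n) (arrivalTime m α β π ω n)

/-- The potential at the time of the `n`-th arrival. -/
noncomputable def potentialAt (m : ℕ) (α β : ℝ) (W : ℕ → ℝ → ℝ) (π : Policy T) (n : ℕ)
    (ω : Sample) : ℝ :=
  if lastTime n (arrivals m α β π ω n) ≤ T then W n (lastTime n (arrivals m α β π ω n)) else 0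

theorem measurable_price_arrivalTime (hα : 0 < α) (hβ : 0 ≤ β) (hT : 0 ≤ T) (π : Policy T) {n : ℕ}
    (hn : n < m) :
    Measurable fun ω => π.price n ω.1 (arrivals m α β π ω n) (arrivalTime m α β π ω n) :=
  (π.measurable n).comp (measurable_fst.prodMk ((measurable_arrivals hα hβ hT π hn.le).prodMk
    (measurable_arrivalTime hα hβ hT π hn)))

theorem measurable_gain (hα : 0 < α) (hβ : 0 ≤ β) (hT : 0 ≤ T) (hW : IsPotential m T W W')
    (π : Policy T) {n : ℕ} (hn : n < m) : Measurable (gain m α β W W' π n) := by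
  unfold gain gainAt
  have h := measurable_arrivalTime (m := m) hα hβ hT π hn
  refine Measurable.ite (measurableSet_le h measurable_const) ?_ measurable_const
  exact ((((hW.measurable_deriv n hn.le).comp h).neg.mul
    (measurable_price_arrivalTime hα hβ hT π hn).exp).div_const _).add
    ((hW.measurable n hn.le).comp h)

theorem measurable_potentialAt (hα : 0 < α) (hβ : 0 ≤ β) (hT : 0 ≤ T) (hW : IsPotential m T W W')
    (π : Policy T) {n : ℕ} (hn : n ≤ m) : Measurable (potentialAt m α β W π n) := by
  have h := (measurable_lastTime n).comp (measurable_arrivals (m := m) hα hβ hT π hn)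
  exact Measurable.ite (measurableSet_le h measurable_const) ((hW.measurable n hn).comp h)
    measurable_const

theorem potentialAt_nonneg (hα : 0 < α) (hβ : 0 ≤ β) (hT : 0 ≤ T) (hW : IsPotential m T W W')
    (π : Policy T) {n : ℕ} (hn : n ≤ m) (ω : Sample) : 0 ≤ potentialAt m α β W π n ω := by
  unfold potentialAt
  split_ifs with h
  · exact hW.nonneg hn ⟨lastTime_arrivals_nonneg hα hβ hT π ω hn, h⟩
  · exact le_rfl

theorem integrable_potentialAt (hα : 0 < α) (hβ : 0 ≤ β) (hT : 0 ≤ T)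
    (hW : IsPotential m T W W') (π : Policy T) {n : ℕ} (hn : n ≤ m) :
    Integrable (potentialAt m α β W π n) sampleMeasure := by
  refine Integrable.of_bound
    (measurable_potentialAt hα hβ hT hW π hn).aestronglyMeasurable (W n 0)
    (Eventually.of_forall fun ω => ?_)
  rw [Real.norm_of_nonneg (potentialAt_nonneg hα hβ hT hW π hn ω)]
  unfold potentialAt
  split_ifs with h
  · exact hW.le_initial hn ⟨lastTime_arrivals_nonneg hα hβ hT π ω hn, h⟩
  · exact hW.nonneg hn ⟨le_rfl, hT⟩

theorem gain_nonneg (hα : 0 < α) (hβ : 0 ≤ β) (hT : 0 ≤ T) (hW : IsPotential m T W W')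
    (π : Policy T) {n : ℕ} (hn : n < m) (ω : Sample) : 0 ≤ gain m α β W W' π n ω := by
  unfold gain gainAt
  split_ifs with h
  · have ht : arrivalTime m α β π ω n ∈ Icc 0 T :=
      ⟨(lastTime_arrivals_nonneg hα hβ hT π ω hn.le).trans
        (lastTime_le_arrivalTime hα hβ hT π ω hn), h⟩
    have h1 := hW.deriv_nonpos n hn.le _ ht
    have h2 := hW.nonneg hn.le ht
    have h3 := baseRate_pos hα hβ hn
    have : 0 ≤ -W' n (arrivalTime m α β π ω n) := by linarith
    positivity
  · exact le_rfl

theorem lintegral_gain (hα : 0 < α) (hβ : 0 ≤ β) (hT : 0 ≤ T) (hW : IsPotential m T W W')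
    (π : Policy T) {n : ℕ} (hn : n < m) :
    ∫⁻ ω, ENNReal.ofReal (gain m α β W W' π n ω) ∂sampleMeasure =
      ∫⁻ ω, ENNReal.ofReal (potentialAt m α β W π n ω) ∂sampleMeasure := by
  rw [lintegral_sample_update (measurable_gain hα hβ hT hW π hn).ennreal_ofReal n]
  refine lintegral_congr fun ω => ?_
  unfold potentialAt
  rw [← lintegral_gainAt hα hβ hT hW π ω.1 hn (lastTime_arrivals_nonneg hα hβ hT π ω hn.le)]
  refine lintegral_congr fun e => ?_
  unfold gain arrivalTime
  rw [arrivals_update π ω.1 ω.2 n e]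
  simp

/-- Prices need not be bounded, so exp(p) has no a priori bound; integrability comes from the
identity between lower integrals, the gain being nonnegative and the potential bounded. -/
theorem integrable_gain (hα : 0 < α) (hβ : 0 ≤ β) (hT : 0 ≤ T) (hW : IsPotential m T W W')
    (π : Policy T) {n : ℕ} (hn : n < m) : Integrable (gain m α β W W' π n) sampleMeasure := by
  refine ⟨(measurable_gain hα hβ hT hW π hn).aestronglyMeasurable, ?_⟩
  rw [hasFiniteIntegral_iff_ofReal (Eventually.of_forall (gain_nonneg hα hβ hT hW π hn)),
    lintegral_gain hα hβ hT hW π hn]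
  exact (hasFiniteIntegral_iff_ofReal
    (Eventually.of_forall (potentialAt_nonneg hα hβ hT hW π hn.le))).1
    (integrable_potentialAt hα hβ hT hW π hn.le).2

theorem integral_gain (hα : 0 < α) (hβ : 0 ≤ β) (hT : 0 ≤ T) (hW : IsPotential m T W W')
    (π : Policy T) {n : ℕ} (hn : n < m) :
    ∫ ω, gain m α β W W' π n ω ∂sampleMeasure =
      ∫ ω, potentialAt m α β W π n ω ∂sampleMeasure := by
  rw [integral_eq_lintegral_of_nonneg_ae (Eventually.of_forall (gain_nonneg hα hβ hT hW π hn))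
    (measurable_gain hα hβ hT hW π hn).aestronglyMeasurable,
    integral_eq_lintegral_of_nonneg_ae
    (Eventually.of_forall (potentialAt_nonneg hα hβ hT hW π hn.le))
    (measurable_potentialAt hα hβ hT hW π hn.le).aestronglyMeasurable,
    lintegral_gain hα hβ hT hW π hn]

/-- The sum of the compensated gains. -/
noncomputable def totalGain (m : ℕ) (α β : ℝ) (W W' : ℕ → ℝ → ℝ) (π : Policy T)
    (ω : Sample) : ℝ :=
  ∑ n ∈ Finset.range m, (gain m α β W W' π n ω - potentialAt m α β W π (n + 1) ω)

theorem integrable_totalGain (hα : 0 < α) (hβ : 0 ≤ β) (hT : 0 ≤ T) (hW : IsPotential m T W W')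
    (π : Policy T) : Integrable (totalGain m α β W W' π) sampleMeasure := by
  refine integrable_finsetSum _ fun n hn => ?_
  have hn' := Finset.mem_range.1 hn
  exact (integrable_gain hα hβ hT hW π hn').sub (integrable_potentialAt hα hβ hT hW π hn')

/-- The expectation of the n-th gain is that of the potential at the n-th arrival, so the sum
telescopes. -/
theorem integral_totalGain (hα : 0 < α) (hβ : 0 ≤ β) (hT : 0 ≤ T) (hW : IsPotential m T W W')
    (π : Policy T) :
    ∫ ω, totalGain m α β W W' π ω ∂sampleMeasure =
      W 0 0 - ∫ ω, potentialAt m α β W π m ω ∂sampleMeasure := by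
  unfold totalGain
  rw [integral_finsetSum]
  · have : ∀ n ∈ Finset.range m,
        ∫ ω, (gain m α β W W' π n ω - potentialAt m α β W π (n + 1) ω) ∂sampleMeasure =
        ∫ ω, potentialAt m α β W π n ω ∂sampleMeasure -
        ∫ ω, potentialAt m α β W π (n + 1) ω ∂sampleMeasure := by
      intro n hn
      have hn' := Finset.mem_range.1 hn
      rw [integral_sub (integrable_gain hα hβ hT hW π hn')
        (integrable_potentialAt hα hβ hT hW π hn'), integral_gain hα hβ hT hW π hn']
    rw [Finset.sum_congr rfl this,
      Finset.sum_range_sub' (fun n => ∫ ω, potentialAt m α β W π n ω ∂sampleMeasure)]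
    congr 1
    simp [potentialAt, lastTime, hT]
  · intro n hn
    have hn' := Finset.mem_range.1 hn
    exact (integrable_gain hα hβ hT hW π hn').sub (integrable_potentialAt hα hβ hT hW π hn')

/-- Supersolutions of the Hamilton-Jacobi-Bellman equation bound every expected revenue. -/
theorem integral_revenue_le (hα : 0 < α) (hβ : 0 ≤ β) (hT : 0 ≤ T) (hW : IsPotential m T W W')
    (hsup : ∀ n < m, ∀ t ∈ Icc 0 T,
      baseRate m α β n * Real.exp (W (n + 1) t - W n t - 1) ≤ -W' n t)
    (π : Policy T) (hR : Integrable (revenue m α β π) sampleMeasure) :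
    ∫ ω, revenue m α β π ω ∂sampleMeasure ≤ W 0 0 := by
  have h1 : ∫ ω, revenue m α β π ω ∂sampleMeasure ≤
      ∫ ω, totalGain m α β W W' π ω ∂sampleMeasure := by
    refine integral_mono hR (integrable_totalGain hα hβ hT hW π) fun ω => ?_
    refine Finset.sum_le_sum fun n hn => ?_
    have hn' := Finset.mem_range.1 hn
    unfold gain potentialAt gainAt
    rw [lastTime_arrivals_succ]
    split_ifs with h
    · have ht : arrivalTime m α β π ω n ∈ Icc 0 T :=
        ⟨(lastTime_arrivals_nonneg hα hβ hT π ω hn'.le).trans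
          (lastTime_le_arrivalTime hα hβ hT π ω hn'), h⟩
      set t := arrivalTime m α β π ω n
      set p := π.price n ω.1 (arrivals m α β π ω n) t
      have hq := baseRate_pos hα hβ hn'
      have h2 := hsup n hn' t ht
      -- Equality holds at p = 1 - (W_{n+1} - W_n), the price maximizing the Hamiltonian; this gives
      -- the comparison realization by realization.
      have h3 := Real.add_one_le_exp (p + (W (n + 1) t - W n t - 1))
      rw [Real.exp_add] at h3
      have h4 : Real.exp p * Real.exp (W (n + 1) t - W n t - 1) ≤
          -W' n t * Real.exp p / baseRate m α β n := by
        rw [le_div_iff₀ hq]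
        nlinarith [Real.exp_pos p]
      linarith
    · simp
  have h2 : 0 ≤ ∫ ω, potentialAt m α β W π m ω ∂sampleMeasure :=
    integral_nonneg (potentialAt_nonneg hα hβ hT hW π le_rfl)
  rw [integral_totalGain hα hβ hT hW π] at h1
  linarith

/-- Solutions of the Hamilton-Jacobi-Bellman equation give the expected revenue of the policy that
attains the maximum in it. -/
theorem integral_revenue_eq (hα : 0 < α) (hβ : 0 ≤ β) (hT : 0 ≤ T) (hW : IsPotential m T W W')
    (heq : ∀ n < m, ∀ t ∈ Icc 0 T,
      baseRate m α β n * Real.exp (W (n + 1) t - W n t - 1) = -W' n t)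
    (hWm : ∀ t ∈ Icc 0 T, W m t = 0)
    (π : Policy T) (hπ : ∀ n < m, ∀ u h, ∀ t ∈ Icc 0 T,
      π.price n u h t = 1 - (W (n + 1) t - W n t)) :
    Integrable (revenue m α β π) sampleMeasure ∧
      ∫ ω, revenue m α β π ω ∂sampleMeasure = W 0 0 := by
  have h1 : revenue m α β π = totalGain m α β W W' π := by
    funext ω
    refine Finset.sum_congr rfl fun n hn => ?_
    have hn' := Finset.mem_range.1 hn
    unfold gain potentialAt gainAt
    rw [lastTime_arrivals_succ]
    split_ifs with h
    · have ht : arrivalTime m α β π ω n ∈ Icc 0 T :=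
        ⟨(lastTime_arrivals_nonneg hα hβ hT π ω hn'.le).trans
          (lastTime_le_arrivalTime hα hβ hT π ω hn'), h⟩
      set t := arrivalTime m α β π ω n
      have hq := baseRate_pos hα hβ hn'
      have h3 : Real.exp (W (n + 1) t - W n t - 1) * Real.exp (1 - (W (n + 1) t - W n t)) = 1 := by
        rw [← Real.exp_add]; simp
      rw [hπ n hn' _ _ t ht, ← heq n hn' t ht, mul_assoc, h3]
      field_simp
      ring
    · simp
  have h2 : ∫ ω, potentialAt m α β W π m ω ∂sampleMeasure = 0 := by
    have : potentialAt m α β W π m = fun _ => 0 := by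
      funext ω
      unfold potentialAt
      split_ifs with h
      · exact hWm _ ⟨lastTime_arrivals_nonneg hα hβ hT π ω le_rfl, h⟩
      · rfl
    simp [this]
  rw [h1]
  refine ⟨integrable_totalGain hα hβ hT hW π, ?_⟩
  rw [integral_totalGain hα hβ hT hW π, h2, sub_zero]

end Verification
-- The optimal deterministic trajectory and the upper bounds it certifies.
section Deterministic

open Set Filter Topology

/-- The adoption rate per potential customer at price `0`. -/
noncomputable def growth (α β x : ℝ) : ℝ := (α + β * x) * (1 - x)

theorem rate_eq_growth (m : ℕ) (α β p x : ℝ) :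
    rate m α β p x = m * (Real.exp (-p) * growth α β x) := by
  unfold rate growth; ring

theorem baseRate_eq_growth (m : ℕ) (α β : ℝ) (n : ℕ) :
    baseRate m α β n = m * growth α β (n / m) := by
  simp [baseRate, rate_eq_growth]

theorem continuous_growth (α β : ℝ) : Continuous (growth α β) := by
  unfold growth; fun_prop

/-- The derivative of `growth`. -/
noncomputable def growthDeriv (α β x : ℝ) : ℝ := β * (1 - x) - (α + β * x)

theorem continuous_growthDeriv (α β : ℝ) : Continuous (growthDeriv α β) := by
  unfold growthDeriv; fun_prop

theorem hasDerivAt_growth (α β x : ℝ) : HasDerivAt (growth α β) (growthDeriv α β x) x := by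
  have h1 : HasDerivAt (fun x : ℝ => α + β * x) β x := by
    simpa using ((hasDerivAt_id x).const_mul β).const_add α
  have h2 : HasDerivAt (fun x : ℝ => 1 - x) (-1) x := by
    simpa using (hasDerivAt_id x).const_sub 1
  have h3 := h1.fun_mul h2
  refine h3.congr_deriv ?_
  unfold growthDeriv; ring

theorem growth_pos {α β x : ℝ} (hα : 0 < α) (hβ : 0 ≤ β) (hx0 : 0 ≤ x) (hx1 : x < 1) :
    0 < growth α β x := by
  unfold growth
  have : 0 < 1 - x := by linarith
  positivity

theorem growth_nonneg {α β x : ℝ} (hα : 0 < α) (hβ : 0 ≤ β) (hx : x ∈ Icc (0 : ℝ) 1) :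
    0 ≤ growth α β x := by
  unfold growth
  have := hx.1
  have : 0 ≤ 1 - x := by linarith [hx.2]
  positivity

/-- Concavity: the quadratic coefficient is -β. Both upper bounds rest on this. -/
theorem growth_le_tangent {α β : ℝ} (hβ : 0 ≤ β) (x z : ℝ) :
    growth α β z ≤ growth α β x + growthDeriv α β x * (z - x) := by
  unfold growth growthDeriv
  nlinarith [mul_nonneg hβ (sq_nonneg (z - x))]

/-- The adoption level which the optimal trajectory of the deterministic model reaches at the
horizon `T`. -/
structure IsEndpoint (α β T y : ℝ) : Prop where
  nonneg : 0 ≤ y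
  lt_one : y < 1
  eq : Real.exp 1 * y = T * growth α β y

theorem exists_isEndpoint {α β T : ℝ} (hα : 0 < α) (hT : 0 ≤ T) :
    ∃ y, IsEndpoint α β T y := by
  have hcont : ContinuousOn (fun y => Real.exp 1 * y - T * growth α β y) (Icc 0 1) := by
    have := continuous_growth α β
    fun_prop
  have h0 : Real.exp 1 * 0 - T * growth α β 0 ≤ 0 := by
    have : 0 ≤ T * α := by positivity
    simp [growth]; linarith
  have h1 : 0 < Real.exp 1 * 1 - T * growth α β 1 := by
    have := Real.exp_pos 1
    simp [growth, this]
  obtain ⟨y, hy, hy'⟩ := intermediate_value_Icc zero_le_one hcont ⟨h0, h1.le⟩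
  refine ⟨y, hy.1, lt_of_le_of_ne hy.2 ?_, by simpa [sub_eq_zero] using hy'⟩
  rintro rfl
  exact h1.ne' hy'

/-- The constant speed of adoption along the optimal trajectory. -/
noncomputable def speed (α β y : ℝ) : ℝ := growth α β y / Real.exp 1

/-- The shadow price of adoption along the optimal trajectory. -/
noncomputable def shadow (α β y t : ℝ) : ℝ :=
  Real.log (growth α β y) - Real.log (growth α β (speed α β y * t))

/-- The derivative of `shadow` in time. -/
noncomputable def shadowDeriv (α β y t : ℝ) : ℝ :=
  -(speed α β y * growthDeriv α β (speed α β y * t) / growth α β (speed α β y * t))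

/-- The remaining revenue per potential customer along the optimal trajectory. -/
noncomputable def revenueToGo (α β T y t : ℝ) : ℝ :=
  ∫ s in t..T, speed α β y * (1 - shadow α β y (max 0 (min T s)))

variable {α β T y : ℝ}

theorem measurable_shadow (α β y : ℝ) : Measurable (shadow α β y) := by
  unfold shadow
  have := continuous_growth α β
  fun_prop

theorem speed_pos (hα : 0 < α) (hβ : 0 ≤ β) (hy : IsEndpoint α β T y) : 0 < speed α β y :=
  div_pos (growth_pos hα hβ hy.nonneg hy.lt_one) (Real.exp_pos 1)

theorem speed_mul_horizon (hy : IsEndpoint α β T y) : speed α β y * T = y := by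
  have := (Real.exp_pos 1).ne'
  unfold speed
  rw [div_mul_eq_mul_div, mul_comm, ← hy.eq]
  field_simp

theorem speed_mul_mem (hα : 0 < α) (hβ : 0 ≤ β) (hy : IsEndpoint α β T y) {t : ℝ}
    (ht : t ∈ Icc 0 T) : 0 ≤ speed α β y * t ∧ speed α β y * t < 1 := by
  have h1 := speed_pos hα hβ hy
  refine ⟨mul_nonneg h1.le ht.1, ?_⟩
  have h2 := mul_le_mul_of_nonneg_left ht.2 h1.le
  rw [speed_mul_horizon hy] at h2
  exact h2.trans_lt hy.lt_one

theorem growth_speed_pos (hα : 0 < α) (hβ : 0 ≤ β) (hy : IsEndpoint α β T y) {t : ℝ}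
    (ht : t ∈ Icc 0 T) : 0 < growth α β (speed α β y * t) :=
  growth_pos hα hβ (speed_mul_mem hα hβ hy ht).1 (speed_mul_mem hα hβ hy ht).2

theorem shadow_horizon (hy : IsEndpoint α β T y) : shadow α β y T = 0 := by
  rw [shadow, speed_mul_horizon hy, sub_self]

theorem exp_shadow_sub_one (hα : 0 < α) (hβ : 0 ≤ β) (hy : IsEndpoint α β T y) {t : ℝ}
    (ht : t ∈ Icc 0 T) :
    Real.exp (shadow α β y t - 1) = speed α β y / growth α β (speed α β y * t) := by
  rw [shadow, Real.exp_sub, Real.exp_sub, Real.exp_log (growth_speed_pos hα hβ hy ht),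
    Real.exp_log (growth_pos hα hβ hy.nonneg hy.lt_one), speed]
  field_simp

theorem hasDerivAt_shadow (hα : 0 < α) (hβ : 0 ≤ β) (hy : IsEndpoint α β T y) {t : ℝ}
    (ht : t ∈ Icc 0 T) : HasDerivAt (shadow α β y) (shadowDeriv α β y t) t := by
  have h1 : HasDerivAt (fun t => speed α β y * t) (speed α β y) t := by
    simpa using (hasDerivAt_id t).const_mul (speed α β y)
  have h2 := ((hasDerivAt_growth α β (speed α β y * t)).comp t h1).log
    (growth_speed_pos hα hβ hy ht).ne'
  refine (h2.const_sub (Real.log (growth α β y))).congr_deriv ?_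
  rw [shadowDeriv, mul_comm (speed α β y) (growthDeriv _ _ _)]
  rfl

theorem continuousOn_shadowDeriv (hα : 0 < α) (hβ : 0 ≤ β) (hy : IsEndpoint α β T y) :
    ContinuousOn (shadowDeriv α β y) (Icc 0 T) := by
  unfold shadowDeriv
  have h1 := continuous_growth α β
  have h2 := continuous_growthDeriv α β
  refine (ContinuousOn.div (by fun_prop) (by fun_prop) fun t ht => ?_).neg
  exact (growth_speed_pos hα hβ hy ht).ne'

theorem continuousOn_shadow (hα : 0 < α) (hβ : 0 ≤ β) (hy : IsEndpoint α β T y) :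
    ContinuousOn (shadow α β y) (Icc 0 T) := fun _ ht =>
  (hasDerivAt_shadow hα hβ hy ht).continuousAt.continuousWithinAt

/-- Clamping time to [0, T] makes the integrand of `revenueToGo` continuous on the whole line, which
gives two-sided derivatives at 0 and T too. -/
theorem continuous_clamped_shadow (hα : 0 < α) (hβ : 0 ≤ β) (hT : 0 ≤ T)
    (hy : IsEndpoint α β T y) : Continuous fun s => shadow α β y (max 0 (min T s)) :=
  (continuousOn_shadow hα hβ hy).comp_continuous (by fun_prop) fun s =>
    ⟨le_max_left _ _, max_le hT (min_le_left _ _)⟩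

theorem clamp_of_mem {t : ℝ} (ht : t ∈ Icc 0 T) : max 0 (min T t) = t := by
  rw [min_eq_right ht.2, max_eq_right ht.1]

theorem hasDerivAt_revenueToGo (hα : 0 < α) (hβ : 0 ≤ β) (hT : 0 ≤ T) (hy : IsEndpoint α β T y)
    {t : ℝ} (ht : t ∈ Icc 0 T) :
    HasDerivAt (revenueToGo α β T y) (-(speed α β y * (1 - shadow α β y t))) t := by
  have hc := continuous_clamped_shadow hα hβ hT hy
  have hc' : Continuous fun s => speed α β y * (1 - shadow α β y (max 0 (min T s))) := by
    fun_prop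
  have := intervalIntegral.integral_hasDerivAt_left (hc'.intervalIntegrable t T)
    (hc'.stronglyMeasurableAtFilter _ _) hc'.continuousAt
  rw [clamp_of_mem ht] at this
  exact this

theorem revenueToGo_zero (hT : 0 ≤ T) :
    revenueToGo α β T y 0 = ∫ s in (0 : ℝ)..T, speed α β y * (1 - shadow α β y s) := by
  refine intervalIntegral.integral_congr fun s hs => ?_
  rw [uIcc_of_le hT] at hs
  simp only [clamp_of_mem hs]

/-- The value function of the stochastic model, linearized along the optimal trajectory of the
deterministic model. -/
noncomputable def tangentPotential (m : ℕ) (α β T y : ℝ) (n : ℕ) (t : ℝ) : ℝ :=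
  m * revenueToGo α β T y t + shadow α β y t * (n - m * (speed α β y * t))

/-- The time derivative of `tangentPotential`. -/
noncomputable def tangentPotentialDeriv (m : ℕ) (α β y : ℝ) (n : ℕ) (t : ℝ) : ℝ :=
  -(m * speed α β y) + shadowDeriv α β y t * (n - m * (speed α β y * t))

/-- The supersolution inequality: increments of `tangentPotential` in n equal the shadow price, and
its time derivative is the tangent to g at x = rt, evaluated at n/m and scaled by -m r / g(x). -/
theorem baseRate_mul_exp_le (hα : 0 < α) (hβ : 0 ≤ β) (hy : IsEndpoint α β T y) {m n : ℕ}
    (hm : 0 < m) {t : ℝ} (ht : t ∈ Icc 0 T) :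
    baseRate m α β n * Real.exp (shadow α β y t - 1) ≤ -tangentPotentialDeriv m α β y n t := by
  have hg := growth_speed_pos hα hβ hy ht
  have hr := speed_pos hα hβ hy
  have hm' : (0 : ℝ) < m := by exact_mod_cast hm
  rw [exp_shadow_sub_one hα hβ hy ht, baseRate_eq_growth, tangentPotentialDeriv, shadowDeriv]
  have h1 := growth_le_tangent (α := α) hβ (speed α β y * t) ((n : ℝ) / m)
  set x := speed α β y * t
  have h2 := mul_le_mul_of_nonneg_left h1
    (show 0 ≤ m * (speed α β y / growth α β x) by positivity)
  refine le_trans (le_of_eq (by ring)) (h2.trans (le_of_eq ?_))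
  field_simp
  ring

theorem isPotential_tangentPotential (hα : 0 < α) (hβ : 0 ≤ β) (hT : 0 ≤ T)
    (hy : IsEndpoint α β T y) {m : ℕ} (hm : 0 < m) :
    IsPotential m T (tangentPotential m α β T y) (tangentPotentialDeriv m α β y) where
  measurable n _ := by
    unfold tangentPotential
    have h1 := measurable_shadow α β y
    have h2 : Measurable (revenueToGo α β T y) := by
      have hc := continuous_clamped_shadow hα hβ hT hy
      have hc' : Continuous fun s => speed α β y * (1 - shadow α β y (max 0 (min T s))) := by
        fun_prop
      refine Continuous.measurable ?_
      refine continuous_iff_continuousAt.2 fun t => ?_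
      exact (intervalIntegral.integral_hasDerivAt_left (hc'.intervalIntegrable t T)
        (hc'.stronglyMeasurableAtFilter _ _) hc'.continuousAt).continuousAt
    fun_prop
  measurable_deriv n _ := by
    unfold tangentPotentialDeriv shadowDeriv
    have h1 := (continuous_growth α β).measurable
    have h2 := (continuous_growthDeriv α β).measurable
    fun_prop
  hasDerivAt n _ t ht := by
    have h1 := (hasDerivAt_revenueToGo hα hβ hT hy ht).const_mul (m : ℝ)
    have h2 : HasDerivAt (fun t => (n : ℝ) - m * (speed α β y * t)) (-(m * speed α β y)) t := by
      simpa using (((hasDerivAt_id t).const_mul (speed α β y)).const_mul (m : ℝ)).const_sub (n : ℝ)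
    refine (h1.add ((hasDerivAt_shadow hα hβ hy ht).mul h2)).congr_deriv ?_
    unfold tangentPotentialDeriv
    ring
  continuousOn n _ := by
    unfold tangentPotentialDeriv
    have := continuousOn_shadowDeriv hα hβ hy
    fun_prop
  terminal n _ := by
    simp [tangentPotential, revenueToGo, shadow_horizon hy]
  deriv_nonpos n hn t ht := by
    have h1 := baseRate_mul_exp_le hα hβ hy (n := n) hm ht
    have h2 : 0 ≤ baseRate m α β n := by
      rcases hn.lt_or_eq with h | h
      · exact (baseRate_pos hα hβ h).le
      · rw [h, baseRate_eq hm, sub_self, mul_zero]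
    have := mul_nonneg h2 (Real.exp_pos (shadow α β y t - 1)).le
    linarith

/-- The expected revenue of a policy is at most the revenue of the optimal trajectory of the
deterministic model. -/
theorem stochRevenues_le (hα : 0 < α) (hβ : 0 ≤ β) (hT : 0 ≤ T) (hy : IsEndpoint α β T y)
    {m : ℕ} (hm : 0 < m) {v : ℝ} (hv : v ∈ stochRevenues m α β T) :
    v ≤ m * revenueToGo α β T y 0 := by
  obtain ⟨π, hR, rfl⟩ := hv
  have := integral_revenue_le hα hβ hT (isPotential_tangentPotential hα hβ hT hy hm)
    (fun n _ t ht => ?_) π hR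
  · simpa [tangentPotential] using this
  · have h : tangentPotential m α β T y (n + 1) t - tangentPotential m α β T y n t =
        shadow α β y t := by
      simp only [tangentPotential]; push_cast; ring
    rw [h]
    exact baseRate_mul_exp_le hα hβ hy hm ht

/-- The price 1 - s cancels g(rt), making the adoption rate constantly m r. -/
theorem mem_detRevenues (hα : 0 < α) (hβ : 0 ≤ β) (hT : 0 ≤ T) (hy : IsEndpoint α β T y)
    (m : ℕ) : m * revenueToGo α β T y 0 ∈ detRevenues m α β T := by
  have hrate : ∀ t ∈ Icc 0 T,
      rate m α β (1 - shadow α β y t) (speed α β y * t) = m * speed α β y := by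
    intro t ht
    have := growth_speed_pos hα hβ hy ht
    rw [rate_eq_growth, neg_sub, exp_shadow_sub_one hα hβ hy ht, div_mul_cancel₀ _ this.ne']
  have hcont := continuousOn_shadow hα hβ hy
  refine ⟨fun t => 1 - shadow α β y t, fun t => speed α β y * t,
    ⟨(measurable_shadow α β y).const_sub 1, ?_, by fun_prop, fun t ht => ?_, fun t ht => ?_⟩,
    ?_, ?_⟩
  · apply ContinuousOn.intervalIntegrable
    rw [uIcc_of_le hT]
    fun_prop
  · have := speed_mul_mem hα hβ hy ht
    exact ⟨this.1, this.2.le⟩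
  · have : ∫ s in (0 : ℝ)..t, rate m α β (1 - shadow α β y s) (speed α β y * s) =
        ∫ s in (0 : ℝ)..t, m * speed α β y := by
      refine intervalIntegral.integral_congr fun s hs => ?_
      rw [uIcc_of_le ht.1] at hs
      exact hrate s ⟨hs.1, hs.2.trans ht.2⟩
    rw [this, intervalIntegral.integral_const]
    simp only [smul_eq_mul]
    ring
  · have h1 : IntervalIntegrable (fun t => (1 - shadow α β y t) * (m * speed α β y)) volume 0 T := by
      apply ContinuousOn.intervalIntegrable
      rw [uIcc_of_le hT]
      fun_prop
    refine h1.congr fun t ht => ?_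
    rw [uIoc_of_le hT] at ht
    simp only [hrate t (Ioc_subset_Icc_self ht)]
  · rw [revenueToGo_zero hT, ← intervalIntegral.integral_const_mul]
    refine intervalIntegral.integral_congr fun t ht => ?_
    rw [uIcc_of_le hT] at ht
    simp only [hrate t ht]
    ring

theorem detRevenues_le (hα : 0 < α) (hβ : 0 ≤ β) (hT : 0 ≤ T) (hy : IsEndpoint α β T y)
    {m : ℕ} (hm : 0 < m) {v : ℝ} (hv : v ∈ detRevenues m α β T) :
    v ≤ m * revenueToGo α β T y 0 := by
  obtain ⟨p, X, hX, hint, rfl⟩ := hv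
  have hm' : (0 : ℝ) < m := by exact_mod_cast hm
  set f : ℝ → ℝ := fun t => Real.exp (-p t) * growth α β (X t) with hf
  have hfint : IntervalIntegrable f volume 0 T := by
    refine hX.integrable.mul_continuousOn ?_
    rw [uIcc_of_le hT]
    exact (continuous_growth α β).comp_continuousOn hX.continuousOn
  have hXf : ∀ t ∈ Icc 0 T, X t = ∫ s in (0 : ℝ)..t, f s := by
    intro t ht
    have h := hX.adoption t ht
    simp only [rate_eq_growth] at h
    rw [intervalIntegral.integral_const_mul] at h
    exact mul_left_cancel₀ hm'.ne' h
  have hFac := hfint.absolutelyContinuousOnInterval_intervalIntegral (c := 0) (by simp)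
  have hlin : AbsolutelyContinuousOnInterval (fun t => speed α β y * t) 0 T :=
    absolutelyContinuousOnInterval_of_hasDerivAt hT (W' := fun _ => speed α β y)
      (fun t _ => by simpa using (hasDerivAt_id t).const_mul (speed α β y)) continuousOn_const
  have hSac := absolutelyContinuousOnInterval_of_hasDerivAt hT
    (fun t ht => hasDerivAt_shadow hα hβ hy ht) (continuousOn_shadowDeriv hα hβ hy)
  have hUac := hFac.fun_sub hlin
  have hparts := hSac.integral_deriv_mul_eq_sub hUac
  rw [shadow_horizon hy, intervalIntegral.integral_same] at hparts
  simp only [mul_zero, zero_mul, sub_zero] at hparts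
  have hbc := continuousOn_shadow hα hβ hy
  have hbc' := continuousOn_shadowDeriv hα hβ hy
  have hI1 : IntervalIntegrable (fun t => speed α β y * (1 - shadow α β y t)) volume 0 T := by
    apply ContinuousOn.intervalIntegrable
    rw [uIcc_of_le hT]
    fun_prop
  have hI2 : IntervalIntegrable (fun t => shadowDeriv α β y t * (X t - speed α β y * t) +
      shadow α β y t * (f t - speed α β y)) volume 0 T := by
    refine IntervalIntegrable.add ?_ ?_
    · apply ContinuousOn.intervalIntegrable
      rw [uIcc_of_le hT]
      have := hX.continuousOn
      fun_prop
    · refine (hfint.sub intervalIntegrable_const).continuousOn_mul ?_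
      rwa [uIcc_of_le hT]
  -- The integrand is almost everywhere the derivative of s(t)(X_t - rt), which vanishes at 0
  -- because X_0 = 0 and at T because s(T) = 0.
  have hzero : ∫ t in (0 : ℝ)..T, (shadowDeriv α β y t * (X t - speed α β y * t) +
      shadow α β y t * (f t - speed α β y)) = 0 := by
    refine (intervalIntegral.integral_congr_ae ?_).trans hparts
    filter_upwards [hfint.ae_hasDerivAt_integral] with t ht hmem
    have hmem1 : t ∈ uIcc 0 T := uIoc_subset_uIcc hmem
    have hmem2 : t ∈ Icc 0 T := by rwa [uIcc_of_le hT] at hmem1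
    have h1 : HasDerivAt (fun x => (∫ v in (0 : ℝ)..x, f v) - speed α β y * x)
        (f t - speed α β y) t := by
      have := (ht hmem1 0 (by simp)).fun_sub ((hasDerivAt_id t).const_mul (speed α β y))
      simpa using this
    rw [h1.deriv, (hasDerivAt_shadow hα hβ hy hmem2).deriv, hXf t hmem2]
  have hle : ∫ t in (0 : ℝ)..T, p t * rate m α β (p t) (X t) ≤
      ∫ t in (0 : ℝ)..T, m * (speed α β y * (1 - shadow α β y t) -
        (shadowDeriv α β y t * (X t - speed α β y * t) +
          shadow α β y t * (f t - speed α β y))) := by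
    refine intervalIntegral.integral_mono_on hT hint ((hI1.sub hI2).const_mul _) fun t ht => ?_
    have hg := growth_speed_pos hα hβ hy ht
    have hgX := growth_nonneg hα hβ (hX.mem_Icc t ht)
    -- Pointwise optimization over the price; the tangent to g at rt then removes the dependence on
    -- g(X_t).
    have h1 := Real.add_one_le_exp (p t + (shadow α β y t - 1))
    have h2 : Real.exp (-p t) * Real.exp (p t + (shadow α β y t - 1)) =
        Real.exp (shadow α β y t - 1) := by
      rw [← Real.exp_add]; congr 1; ring
    have h3 := mul_le_mul_of_nonneg_left h1 (Real.exp_pos (-p t)).le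
    rw [h2, exp_shadow_sub_one hα hβ hy ht] at h3
    have h4 := mul_le_mul_of_nonneg_right h3 hgX
    have h5 := growth_le_tangent (α := α) hβ (speed α β y * t) (X t)
    have h6 := mul_le_mul_of_nonneg_left h5 (div_pos (speed_pos hα hβ hy) hg).le
    have h7 : speed α β y / growth α β (speed α β y * t) *
        (growth α β (speed α β y * t) +
          growthDeriv α β (speed α β y * t) * (X t - speed α β y * t)) =
        speed α β y - shadowDeriv α β y t * (X t - speed α β y * t) := by
      rw [shadowDeriv]; field_simp; ring
    rw [h7] at h6
    rw [rate_eq_growth]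
    have h8 : p t * f t ≤ speed α β y * (1 - shadow α β y t) -
        (shadowDeriv α β y t * (X t - speed α β y * t) +
          shadow α β y t * (f t - speed α β y)) := by
      simp only [hf]
      linarith
    have h9 := mul_le_mul_of_nonneg_left h8 hm'.le
    simp only [hf] at h9 ⊢
    linarith
  rw [intervalIntegral.integral_const_mul, intervalIntegral.integral_sub hI1 hI2, hzero,
    sub_zero, ← revenueToGo_zero hT] at hle
  exact hle

end Deterministic
-- Explicit solution of the Hamilton-Jacobi-Bellman equation.
section ExactValue

open Set Filter Topology

/-- The coefficients of `expValue`. -/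
noncomputable def valueCoeff (m : ℕ) (α β : ℝ) (n k : ℕ) : ℝ :=
  ∏ j ∈ Finset.range k, baseRate m α β (n + j) / Real.exp 1

/-- The exponential of the value function of the stochastic model after `n` arrivals, in terms of
the remaining time: it solves a linear system of differential equations. -/
noncomputable def expValue (m : ℕ) (α β : ℝ) (n : ℕ) (s : ℝ) : ℝ :=
  ∑ k ∈ Finset.range (m + 1), valueCoeff m α β n k * (s ^ k / k.factorial)

variable {m : ℕ} {α β T : ℝ}

theorem baseRate_self (hm : 0 < m) : baseRate m α β m = 0 := by
  rw [baseRate_eq hm, sub_self, mul_zero]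

/-- The product contains the rate at saturation, which is 0; hence truncating `expValue` at degree m
loses nothing. -/
theorem valueCoeff_eq_zero (hm : 0 < m) {n k : ℕ} (hn : n ≤ m) (hk : m < n + k) :
    valueCoeff m α β n k = 0 := by
  refine Finset.prod_eq_zero (i := m - n) (Finset.mem_range.2 (by omega)) ?_
  rw [show n + (m - n) = m by omega, baseRate_self hm, zero_div]

theorem valueCoeff_pos (hα : 0 < α) (hβ : 0 ≤ β) {n k : ℕ} (hk : n + k ≤ m) :
    0 < valueCoeff m α β n k := by
  refine Finset.prod_pos fun j hj => div_pos (baseRate_pos hα hβ ?_) (Real.exp_pos 1)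
  have := Finset.mem_range.1 hj
  omega

theorem valueCoeff_nonneg (hm : 0 < m) (hα : 0 < α) (hβ : 0 ≤ β) {n : ℕ} (hn : n ≤ m) (k : ℕ) :
    0 ≤ valueCoeff m α β n k := by
  rcases le_or_gt (n + k) m with h | h
  · exact (valueCoeff_pos hα hβ h).le
  · exact (valueCoeff_eq_zero hm hn h).ge

theorem valueCoeff_succ (n k : ℕ) :
    valueCoeff m α β n (k + 1) = baseRate m α β n / Real.exp 1 * valueCoeff m α β (n + 1) k := by
  rw [valueCoeff, Finset.prod_range_succ', mul_comm, valueCoeff, add_zero]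
  congr 1
  refine Finset.prod_congr rfl fun j _ => ?_
  rw [show n + (j + 1) = n + 1 + j by omega]

/-- Differentiation shifts the degree by one, and `valueCoeff_succ` extracts the factor of the
current state. -/
theorem hasDerivAt_expValue (hm : 0 < m) {n : ℕ} (hn : n ≤ m) (s : ℝ) :
    HasDerivAt (expValue m α β n)
      (baseRate m α β n / Real.exp 1 * expValue m α β (n + 1) s) s := by
  have h1 : HasDerivAt (expValue m α β n)
      (∑ k ∈ Finset.range (m + 1),
        valueCoeff m α β n k * ((k : ℝ) * s ^ (k - 1) / k.factorial)) s := by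
    unfold expValue
    refine HasDerivAt.fun_sum fun k _ => ?_
    exact ((hasDerivAt_pow k s).div_const _).const_mul _
  refine h1.congr_deriv ?_
  have hlast : valueCoeff m α β n (m + 1) = 0 := valueCoeff_eq_zero hm hn (by omega)
  rw [valueCoeff_succ] at hlast
  rw [Finset.sum_range_succ', expValue, Finset.mul_sum, Finset.sum_range_succ, ← mul_assoc, hlast,
    zero_mul, add_zero]
  simp only [Nat.cast_zero, zero_mul, zero_div, mul_zero, add_zero]
  refine Finset.sum_congr rfl fun k _ => ?_
  rw [valueCoeff_succ, Nat.factorial_succ, Nat.add_sub_cancel]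
  have : (k.factorial : ℝ) ≠ 0 := by positivity
  push_cast
  field_simp

theorem le_expValue (hm : 0 < m) (hα : 0 < α) (hβ : 0 ≤ β) {n : ℕ} (hn : n ≤ m) {s : ℝ}
    (hs : 0 ≤ s) {k : ℕ} (hk : k ≤ m) :
    valueCoeff m α β n k * (s ^ k / k.factorial) ≤ expValue m α β n s := by
  refine Finset.single_le_sum (f := fun k => valueCoeff m α β n k * (s ^ k / k.factorial))
    (fun k _ => mul_nonneg (valueCoeff_nonneg hm hα hβ hn k) (by positivity))
    (Finset.mem_range.2 (by omega))

theorem one_le_expValue (hm : 0 < m) (hα : 0 < α) (hβ : 0 ≤ β) {n : ℕ} (hn : n ≤ m) {s : ℝ}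
    (hs : 0 ≤ s) : 1 ≤ expValue m α β n s := by
  simpa [valueCoeff] using le_expValue hm hα hβ hn hs (Nat.zero_le m)

theorem expValue_self (hm : 0 < m) (s : ℝ) : expValue m α β m s = 1 := by
  rw [expValue, Finset.sum_range_succ', Finset.sum_eq_zero]
  · simp [valueCoeff]
  · intro k _
    rw [valueCoeff_eq_zero hm le_rfl (by omega), zero_mul]

theorem expValue_zero (n : ℕ) : expValue m α β n 0 = 1 := by
  rw [expValue, Finset.sum_range_succ', Finset.sum_eq_zero]
  · simp [valueCoeff]
  · intro k _
    simp

/-- The value function of the stochastic model after `n` arrivals. -/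
noncomputable def value (m : ℕ) (α β T : ℝ) (n : ℕ) (t : ℝ) : ℝ :=
  Real.log (expValue m α β n (T - t))

/-- The time derivative of `value`. -/
noncomputable def valueDeriv (m : ℕ) (α β T : ℝ) (n : ℕ) (t : ℝ) : ℝ :=
  -(baseRate m α β n / Real.exp 1 * expValue m α β (n + 1) (T - t) / expValue m α β n (T - t))

theorem continuous_expValue (n : ℕ) : Continuous (expValue m α β n) := by
  unfold expValue; fun_prop

theorem expValue_pos (hm : 0 < m) (hα : 0 < α) (hβ : 0 ≤ β) {n : ℕ} (hn : n ≤ m) {t : ℝ}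
    (ht : t ∈ Icc 0 T) : 0 < expValue m α β n (T - t) :=
  one_pos.trans_le (one_le_expValue hm hα hβ hn (sub_nonneg.2 ht.2))

theorem isPotential_value (hm : 0 < m) (hα : 0 < α) (hβ : 0 ≤ β) :
    IsPotential m T (value m α β T) (valueDeriv m α β T) where
  measurable n _ := by
    unfold value
    have := (continuous_expValue (m := m) (α := α) (β := β) n).measurable
    fun_prop
  measurable_deriv n _ := by
    unfold valueDeriv
    have := (continuous_expValue (m := m) (α := α) (β := β) n).measurable
    have := (continuous_expValue (m := m) (α := α) (β := β) (n + 1)).measurable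
    fun_prop
  hasDerivAt n hn t ht := by
    have h1 : HasDerivAt (fun t => T - t) (-1) t := by
      simpa using (hasDerivAt_id t).const_sub T
    have h2 := ((hasDerivAt_expValue (α := α) (β := β) hm hn (T - t)).comp t h1).log
      (expValue_pos hm hα hβ hn ht).ne'
    refine h2.congr_deriv ?_
    simp only [valueDeriv, Function.comp_apply]
    ring
  continuousOn n hn := by
    unfold valueDeriv
    have := continuous_expValue (m := m) (α := α) (β := β) n
    have := continuous_expValue (m := m) (α := α) (β := β) (n + 1)
    refine (ContinuousOn.div (by fun_prop) (by fun_prop) fun t ht => ?_).neg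
    exact (expValue_pos hm hα hβ hn ht).ne'
  terminal n _ := by
    simp [value, expValue_zero]
  deriv_nonpos n hn t ht := by
    rw [valueDeriv, neg_nonpos]
    rcases hn.lt_or_eq with h | h
    · have h1 := expValue_pos hm hα hβ (Nat.succ_le_of_lt h) ht
      have h2 := expValue_pos hm hα hβ hn ht
      have h3 := baseRate_pos hα hβ h
      exact (div_pos (mul_pos (div_pos h3 (Real.exp_pos 1)) h1) h2).le
    · rw [h, baseRate_self hm]; simp

theorem baseRate_mul_exp_value (hm : 0 < m) (hα : 0 < α) (hβ : 0 ≤ β) {n : ℕ} (hn : n < m) {t : ℝ}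
    (ht : t ∈ Icc 0 T) :
    baseRate m α β n * Real.exp (value m α β T (n + 1) t - value m α β T n t - 1) =
      -valueDeriv m α β T n t := by
  rw [value, value, Real.exp_sub, Real.exp_sub,
    Real.exp_log (expValue_pos hm hα hβ (Nat.succ_le_of_lt hn) ht),
    Real.exp_log (expValue_pos hm hα hβ hn.le ht), valueDeriv]
  field_simp

/-- The optimal policy of the stochastic model. -/
noncomputable def optimalPolicy (hm : 0 < m) (hα : 0 < α) (hβ : 0 ≤ β) (hT : 0 ≤ T) :
    Policy T where
  -- The value 0 for n ≥ m is a filler: revenue only involves customers with n < m.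
  price n _ _ t := if n < m then 1 - (value m α β T (n + 1) t - value m α β T n t) else 0
  measurable n := by
    split_ifs with h
    · have h1 := (isPotential_value (T := T) hm hα hβ).measurable n h.le
      have h2 := (isPotential_value (T := T) hm hα hβ).measurable (n + 1) h
      fun_prop
    · exact measurable_const
  integrable n _ _ := by
    split_ifs with h
    · apply ContinuousOn.intervalIntegrable
      rw [uIcc_of_le hT]
      have h1 : ContinuousOn (value m α β T n) (Icc 0 T) := fun t ht =>
        ((isPotential_value hm hα hβ).hasDerivAt n h.le t ht).continuousAt.continuousWithinAt
      have h2 : ContinuousOn (value m α β T (n + 1)) (Icc 0 T) := fun t ht =>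
        ((isPotential_value hm hα hβ).hasDerivAt (n + 1) h t ht).continuousAt.continuousWithinAt
      fun_prop
    · exact intervalIntegrable_const

theorem log_expValue_mem_stochRevenues (hm : 0 < m) (hα : 0 < α) (hβ : 0 ≤ β) (hT : 0 ≤ T) :
    Real.log (expValue m α β 0 T) ∈ stochRevenues m α β T := by
  obtain ⟨h1, h2⟩ := integral_revenue_eq hα hβ hT (isPotential_value hm hα hβ)
    (fun n hn t ht => baseRate_mul_exp_value hm hα hβ hn ht)
    (fun t _ => by simp [value, expValue_self hm])
    (optimalPolicy hm hα hβ hT) (fun n hn u h t _ => by simp [optimalPolicy, hn])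
  exact ⟨_, h1, by simp [h2, value]⟩

end ExactValue

/-! ### Comparison of the two values: Stirling and Riemann sum estimates. -/

section Gap

open Set Filter Topology

variable {m : ℕ} {α β T y : ℝ}

theorem le_mul_log_sub_log {n : ℕ} (hn : 0 < n) :
    1 ≤ ((n : ℝ) + 1) * (Real.log (n + 1) - Real.log n) := by
  have hn' : (0 : ℝ) < n := by exact_mod_cast hn
  have h1 := Real.add_one_le_exp (-(1 / ((n : ℝ) + 1)))
  have h2 : Real.log (n / (n + 1)) ≤ -(1 / ((n : ℝ) + 1)) := by
    rw [Real.log_le_iff_le_exp (by positivity)]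
    refine le_trans (le_of_eq ?_) h1
    field_simp
    ring
  rw [Real.log_div hn'.ne' (by positivity)] at h2
  have h3 : (1 : ℝ) / (n + 1) ≤ Real.log (n + 1) - Real.log n := by linarith
  rwa [div_le_iff₀' (by positivity)] at h3

theorem sum_log_succ_le {n : ℕ} (hn : 0 < n) :
    ∑ j ∈ Finset.range n, Real.log (j + 1) ≤ n * Real.log n - n + 1 + Real.log n := by
  induction n, hn using Nat.le_induction with
  | base => simp
  | succ n hn ih =>
    have h := le_mul_log_sub_log hn
    rw [Finset.sum_range_succ]
    push_cast
    linarith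

/-- A Stirling bound at the real argument n + θ, with log n! and log (n+1)! interpolated linearly.
-/
theorem sum_log_succ_add_le {n : ℕ} {θ : ℝ} (hθ0 : 0 ≤ θ) (hθ1 : θ ≤ 1) (hm : 0 < m) (hnm : n ≤ m) :
    ∑ j ∈ Finset.range n, Real.log (j + 1) + θ * Real.log (n + 1) ≤
      (n + θ) * Real.log (n + θ) - (n + θ) + 2 + Real.log m := by
  have hlogm : 0 ≤ Real.log m := Real.log_nonneg (by exact_mod_cast hm)
  rcases Nat.eq_zero_or_pos n with rfl | hn
  · simp only [Finset.range_zero, Finset.sum_empty, Nat.cast_zero, zero_add, Real.log_one, mul_zero]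
    have : -1 ≤ θ * Real.log θ := by
      rcases hθ0.eq_or_lt with rfl | h
      · simp
      · have h1 := Real.one_sub_inv_le_log_of_pos h
        have h2 := mul_le_mul_of_nonneg_left h1 hθ0
        rw [mul_sub, mul_inv_cancel₀ h.ne'] at h2
        linarith
    linarith
  · have hn' : (1 : ℝ) ≤ n := by exact_mod_cast hn
    have h1 := sum_log_succ_le hn
    have h2 : Real.log n ≤ Real.log m := Real.log_le_log (by linarith) (by exact_mod_cast hnm)
    -- The convex function x log x - x lies above its tangent at n.
    have h3 : n * Real.log n - n + θ * Real.log n ≤ (n + θ) * Real.log (n + θ) - (n + θ) := by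
      have h4 := Real.one_sub_inv_le_log_of_pos (show 0 < (n + θ) / n by positivity)
      rw [Real.log_div (by positivity) (by positivity), inv_div] at h4
      have h5 := mul_le_mul_of_nonneg_left h4 (show 0 ≤ n + θ by positivity)
      have h6 : (n + θ) * (1 - n / (n + θ)) = θ := by field_simp; ring
      rw [h6] at h5
      linarith
    have h7 : θ * (Real.log (n + 1) - Real.log n) ≤ 1 := by
      have h8 : Real.log (n + 1) - Real.log n ≤ 1 := by
        rw [← Real.log_div (by positivity) (by positivity)]
        have h9 := Real.log_le_sub_one_of_pos (show 0 < ((n : ℝ) + 1) / n by positivity)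
        have h10 : ((n : ℝ) + 1) / n ≤ 2 := by rw [div_le_iff₀ (by linarith)]; linarith
        linarith
      have h11 : 0 ≤ Real.log (n + 1) - Real.log n := by
        have := Real.log_le_log (by linarith) (show (n : ℝ) ≤ n + 1 by linarith)
        linarith
      calc _ ≤ 1 * (Real.log (n + 1) - Real.log n) := by gcongr
        _ ≤ 1 := by linarith
    linarith

theorem integral_le_sum_add {f : ℝ → ℝ} {n : ℕ} {θ δ : ℝ} (hθ : 0 ≤ θ) (hθ1 : θ ≤ 1)
    (hf : ContinuousOn f (Icc 0 (n + θ)))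
    (h : ∀ j : ℕ, ∀ u ∈ Icc (0 : ℝ) (n + θ), u ∈ Icc (j : ℝ) (j + 1) → f u ≤ f j + δ) :
    ∫ u in (0 : ℝ)..(n + θ), f u ≤
      ∑ j ∈ Finset.range n, f j + θ * f n + δ * (n + θ) := by
  have hint : ∀ {a b : ℝ}, 0 ≤ a → a ≤ b → b ≤ n + θ → IntervalIntegrable f volume a b := by
    intro a b ha hab hb
    apply ContinuousOn.intervalIntegrable
    rw [uIcc_of_le hab]
    exact hf.mono (Icc_subset_Icc ha hb)
  have hcast : ∀ j < n, ((j : ℕ) : ℝ) + 1 ≤ n := fun j hj => by exact_mod_cast hj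
  have h1 : ∫ u in (0 : ℝ)..n, f u = ∑ j ∈ Finset.range n, ∫ u in (j : ℝ)..((j + 1 : ℕ) : ℝ), f u := by
    have := intervalIntegral.sum_integral_adjacent_intervals (f := f) (μ := volume)
      (a := fun j : ℕ => (j : ℝ)) (n := n) fun j hj => by
        have := hcast j hj
        push_cast
        exact hint (by positivity) (by linarith) (by linarith)
    simpa using this.symm
  have h2 : ∀ j ∈ Finset.range n, ∫ u in (j : ℝ)..((j + 1 : ℕ) : ℝ), f u ≤ f j + δ := by
    intro j hj
    have hj' := hcast j (Finset.mem_range.1 hj)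
    have hj0 : (0 : ℝ) ≤ j := by positivity
    push_cast
    calc ∫ u in (j : ℝ)..((j : ℝ) + 1), f u ≤ ∫ u in (j : ℝ)..((j : ℝ) + 1), (f j + δ) := by
          refine intervalIntegral.integral_mono_on (by linarith)
            (hint hj0 (by linarith) (by linarith)) intervalIntegrable_const fun u hu => ?_
          exact h j u ⟨hj0.trans hu.1, by linarith [hu.2]⟩ hu
      _ = f j + δ := by simp
  have h3 : ∫ u in (n : ℝ)..(n + θ), f u ≤ θ * (f n + δ) := by
    have hn0 : (0 : ℝ) ≤ n := by positivity
    calc ∫ u in (n : ℝ)..(n + θ), f u ≤ ∫ u in (n : ℝ)..(n + θ), (f n + δ) := by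
          refine intervalIntegral.integral_mono_on (by linarith)
            (hint hn0 (by linarith) le_rfl) intervalIntegrable_const fun u hu => ?_
          exact h n u ⟨hn0.trans hu.1, hu.2⟩ ⟨hu.1, by linarith [hu.2]⟩
      _ = θ * (f n + δ) := by simp [mul_add]
  rw [← intervalIntegral.integral_add_adjacent_intervals
    (hint le_rfl (by positivity) (by linarith) : IntervalIntegrable f volume 0 n)
    (hint (by positivity) (by linarith) le_rfl), h1]
  have h4 := Finset.sum_le_sum h2
  rw [Finset.sum_add_distrib, Finset.sum_const, Finset.card_range, nsmul_eq_mul] at h4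
  linarith

/-- The slope of log(α + βx) is at most β/α ≤ ρ, and 1 - x decreases. Only increases are bounded:
log(1 - x) is unbounded below near saturation, and left-endpoint sums need no more. -/
theorem log_growth_le {ρ : ℝ} (hα : 0 < α) (hβ : 0 ≤ β) (hρ : β ≤ ρ * α) (hm : 0 < m)
    {v u : ℝ} (hv : 0 ≤ v) (hvu : v ≤ u) (huv : u ≤ v + 1) (hu : u < m) :
    Real.log (growth α β (u / m)) ≤ Real.log (growth α β (v / m)) + ρ / m := by
  have hm' : (0 : ℝ) < m := by exact_mod_cast hm
  have hρ0 : 0 ≤ ρ := by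
    by_contra h
    nlinarith
  have h1 := growth_pos hα hβ (div_nonneg hv hm'.le) ((div_lt_one hm').2 (hvu.trans_lt hu))
  have h2 := growth_pos hα hβ (div_nonneg (hv.trans hvu) hm'.le) ((div_lt_one hm').2 hu)
  rw [Real.log_le_iff_le_exp h2, Real.exp_add, Real.exp_log h1]
  have h3 : α + β * (u / m) ≤ (α + β * (v / m)) * Real.exp (ρ / m) := by
    have h4 := Real.add_one_le_exp (ρ / m)
    have h5 : u / m ≤ v / m + 1 / m := by
      rw [← add_div]; gcongr
    have h6 : β * (u / m) ≤ β * (v / m) + ρ * α * (1 / m) := by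
      have := mul_le_mul_of_nonneg_left h5 hβ
      have := mul_le_mul_of_nonneg_right hρ (show 0 ≤ 1 / (m : ℝ) by positivity)
      linarith
    have h7 : 0 ≤ β * (v / m) * (ρ / m) := by positivity
    have h8 : 0 ≤ α + β * (v / m) := by positivity
    have h9 := mul_le_mul_of_nonneg_left h4 h8
    have h10 : ρ * α * (1 / m) = α * (ρ / m) := by ring
    linarith
  have h11 : 1 - u / m ≤ 1 - v / m := by gcongr
  have h12 : 0 ≤ 1 - u / m := by
    have := (div_lt_one hm').2 hu
    linarith
  unfold growth
  calc (α + β * (u / m)) * (1 - u / m)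
      ≤ ((α + β * (v / m)) * Real.exp (ρ / m)) * (1 - v / m) := by
        gcongr
    _ = _ := by ring

/-- Substitute u = m r s and eliminate log g(y) through e y = T g(y). The result has the shape of
the logarithm of one monomial of `expValue`, with z log z - z in place of log k!. -/
theorem mul_revenueToGo_eq (hα : 0 < α) (hβ : 0 ≤ β) (hT : 0 < T) (hy : IsEndpoint α β T y)
    (hm : 0 < m) :
    m * revenueToGo α β T y 0 =
      (m * y - m * y * Real.log (m * y)) +
        ∫ u in (0 : ℝ)..(m * y), (Real.log (m * T / Real.exp 1) + Real.log (growth α β (u / m))) := by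
  have hm' : (0 : ℝ) < m := by exact_mod_cast hm
  have hr := speed_pos hα hβ hy
  have hg := growth_pos hα hβ hy.nonneg hy.lt_one
  have hy0 : 0 < y := by rw [← speed_mul_horizon hy]; positivity
  set f : ℝ → ℝ := fun u => 1 - Real.log (growth α β y) + Real.log (growth α β (u / m)) with hf
  have h1 : m * revenueToGo α β T y 0 = ∫ u in (0 : ℝ)..(m * y), f u := by
    have h2 := intervalIntegral.mul_integral_comp_mul_left (f := f) (a := 0) (b := T)
      (c := m * speed α β y)
    rw [mul_zero, mul_assoc (m : ℝ) _ T, speed_mul_horizon hy] at h2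
    rw [← h2, revenueToGo_zero hT.le, intervalIntegral.integral_const_mul, ← mul_assoc]
    congr 1
    refine intervalIntegral.integral_congr fun s _ => ?_
    have h3 : m * speed α β y * s / m = speed α β y * s := by field_simp
    simp only [hf, shadow, h3]
    ring
  have hgy : Real.log (growth α β y) = 1 + Real.log y - Real.log T := by
    have h4 : growth α β y = Real.exp 1 * y / T := by rw [hy.eq]; field_simp
    rw [h4, Real.log_div (by positivity) hT.ne', Real.log_mul (Real.exp_pos 1).ne' hy0.ne',
      Real.log_exp]
  have hcont : ContinuousOn (fun u => Real.log (growth α β (u / m))) (uIcc 0 (m * y)) := by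
    have := continuous_growth α β
    refine ContinuousOn.log (by fun_prop) fun u hu => ?_
    rw [uIcc_of_le (by positivity)] at hu
    refine (growth_pos hα hβ (div_nonneg hu.1 hm'.le) ?_).ne'
    rw [div_lt_one hm']
    have := mul_lt_mul_of_pos_left hy.lt_one hm'
    linarith [hu.2]
  rw [h1, hf, intervalIntegral.integral_add intervalIntegrable_const hcont.intervalIntegrable]
  rw [intervalIntegral.integral_add intervalIntegrable_const hcont.intervalIntegrable,
    intervalIntegral.integral_const, intervalIntegral.integral_const, hgy,
    Real.log_div (by positivity) (Real.exp_pos 1).ne', Real.log_mul hm'.ne' hT.ne', Real.log_exp,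
    Real.log_mul hm'.ne' hy0.ne']
  simp only [smul_eq_mul]
  ring

/-- All terms of `expValue` are nonnegative, so the k-th alone is a lower bound. -/
theorem sum_log_le_log_expValue (hα : 0 < α) (hβ : 0 ≤ β) (hT : 0 < T) (hm : 0 < m) {k : ℕ}
    (hk : k ≤ m) :
    ∑ j ∈ Finset.range k, (Real.log (m * T / Real.exp 1) + Real.log (growth α β (j / m)) -
      Real.log (j + 1)) ≤ Real.log (expValue m α β 0 T) := by
  have hm' : (0 : ℝ) < m := by exact_mod_cast hm
  have h1 := le_expValue hm hα hβ (Nat.zero_le m) hT.le hk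
  have h2 : 0 < valueCoeff m α β 0 k * (T ^ k / k.factorial) :=
    mul_pos (valueCoeff_pos hα hβ (by omega)) (by positivity)
  refine le_trans (le_of_eq ?_) (Real.log_le_log h2 h1)
  have h3 : valueCoeff m α β 0 k * (T ^ k / k.factorial) =
      ∏ j ∈ Finset.range k, (m * T / Real.exp 1 * growth α β (j / m) / (j + 1)) := by
    rw [valueCoeff, ← Finset.prod_range_add_one_eq_factorial, Nat.cast_prod,
      ← Finset.card_range k, ← Finset.prod_const, Finset.card_range, ← Finset.prod_div_distrib,
      ← Finset.prod_mul_distrib]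
    refine Finset.prod_congr rfl fun j _ => ?_
    rw [zero_add, baseRate_eq_growth]
    push_cast
    ring
  have h4 : ∀ j ∈ Finset.range k, 0 < growth α β (j / m) := by
    intro j hj
    refine growth_pos hα hβ (by positivity) ((div_lt_one hm').2 ?_)
    exact_mod_cast (Finset.mem_range.1 hj).trans_le hk
  rw [h3, Real.log_prod fun j hj => by have := h4 j hj; positivity]
  refine Finset.sum_congr rfl fun j hj => ?_
  have := h4 j hj
  rw [← Real.log_mul (by positivity) this.ne', ← Real.log_div (by positivity) (by positivity)]

/-- The optimal revenues of the two models differ by `O(log m)`. -/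
theorem mul_revenueToGo_le {ρ : ℝ} (hα : 0 < α) (hβ : 0 ≤ β) (hρ : β ≤ ρ * α) (hT : 0 ≤ T)
    (hy : IsEndpoint α β T y) (hm : 0 < m) :
    m * revenueToGo α β T y 0 ≤ Real.log (expValue m α β 0 T) + (|ρ| + 2 + Real.log m) := by
  have hm' : (0 : ℝ) < m := by exact_mod_cast hm
  have hlogm : 0 ≤ Real.log m := Real.log_nonneg (by exact_mod_cast hm)
  rcases hT.eq_or_lt with rfl | hT
  · have h1 := Real.log_nonneg (one_le_expValue hm hα hβ (Nat.zero_le m) (le_refl (0 : ℝ)))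
    have := abs_nonneg ρ
    simp only [revenueToGo, intervalIntegral.integral_same, mul_zero]
    linarith
  have hz0 : 0 ≤ m * y := mul_nonneg hm'.le hy.nonneg
  have hzm : m * y < m := by
    have := mul_lt_mul_of_pos_left hy.lt_one hm'
    linarith
  obtain ⟨n, θ, hθ0, hθ1, hz⟩ : ∃ (n : ℕ) (θ : ℝ), 0 ≤ θ ∧ θ ≤ 1 ∧ m * y = n + θ :=
    ⟨⌊m * y⌋₊, m * y - ⌊m * y⌋₊, by linarith [Nat.floor_le hz0],
      by linarith [Nat.lt_floor_add_one (m * y)], by ring⟩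
  have hnm : n < m := by
    have : (n : ℝ) < m := by linarith
    exact_mod_cast this
  set φ : ℝ → ℝ := fun u => Real.log (m * T / Real.exp 1) + Real.log (growth α β (u / m)) with hφ
  have hcont : ContinuousOn φ (Icc 0 (n + θ)) := by
    have := continuous_growth α β
    refine continuousOn_const.add (ContinuousOn.log (by fun_prop) fun u hu => ?_)
    refine (growth_pos hα hβ (div_nonneg hu.1 hm'.le) ?_).ne'
    rw [div_lt_one hm']
    linarith [hu.2]
  have h1 := integral_le_sum_add (δ := |ρ| / m) hθ0 hθ1 hcont fun j u hu huj => by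
    have h2 := log_growth_le hα hβ hρ hm (Nat.cast_nonneg j) huj.1 huj.2 (by linarith [hu.2])
    have h3 : ρ / m ≤ |ρ| / m := by gcongr; exact le_abs_self ρ
    simp only [hφ]
    linarith
  have h4 := sum_log_succ_add_le hθ0 hθ1 hm hnm.le
  have h5 : |ρ| / m * (n + θ) ≤ |ρ| := by
    rw [div_mul_eq_mul_div, div_le_iff₀ hm']
    have := abs_nonneg ρ
    gcongr
    linarith
  have h6 := sum_log_le_log_expValue hα hβ hT hm hnm.le
  have h7 := sum_log_le_log_expValue hα hβ hT hm (Nat.succ_le_of_lt hnm)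
  rw [Finset.sum_range_succ] at h7
  rw [Finset.sum_sub_distrib] at h6 h7
  rw [mul_revenueToGo_eq hα hβ hT hy hm, hz]
  -- The lower bounds for k = n and k = n + 1 are averaged with weights 1 - θ and θ, to match the
  -- non-integer endpoint my = n + θ.
  have h8 := mul_le_mul_of_nonneg_left h6 (sub_nonneg.2 hθ1)
  have h9 := mul_le_mul_of_nonneg_left h7 hθ0
  simp only [hφ] at h1
  linarith

end Gap

/-! ### The two suprema, their gap, and the regret bounds. -/

theorem isLUB_detRevenues {m : ℕ} {α β T y : ℝ} (hm : 0 < m) (hα : 0 < α) (hβ : 0 ≤ β)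
    (hT : 0 ≤ T) (hy : IsEndpoint α β T y) :
    IsLUB (detRevenues m α β T) (m * revenueToGo α β T y 0) :=
  ⟨fun _ hv => detRevenues_le hα hβ hT hy hm hv, fun _ hb => hb (mem_detRevenues hα hβ hT hy m)⟩

theorem VDet_eq {m : ℕ} {α β T y : ℝ} (hm : 0 < m) (hα : 0 < α) (hβ : 0 ≤ β) (hT : 0 ≤ T)
    (hy : IsEndpoint α β T y) : VDet m α β T = m * revenueToGo α β T y 0 :=
  (isLUB_detRevenues hm hα hβ hT hy).csSup_eq ⟨_, mem_detRevenues hα hβ hT hy m⟩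

theorem isLUB_stochRevenues {m : ℕ} {α β T : ℝ} (hm : 0 < m) (hα : 0 < α) (hβ : 0 ≤ β)
    (hT : 0 ≤ T) : IsLUB (stochRevenues m α β T) (VStoch m α β T) := by
  obtain ⟨y, hy⟩ := exists_isEndpoint (β := β) hα hT
  exact isLUB_csSup ⟨_, log_expValue_mem_stochRevenues hm hα hβ hT⟩
    ⟨_, fun _ hv => stochRevenues_le hα hβ hT hy hm hv⟩

theorem VStoch_le_VDet {m : ℕ} {α β T : ℝ} (hm : 0 < m) (hα : 0 < α) (hβ : 0 ≤ β)
    (hT : 0 ≤ T) : VStoch m α β T ≤ VDet m α β T := by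
  obtain ⟨y, hy⟩ := exists_isEndpoint (β := β) hα hT
  rw [VDet_eq hm hα hβ hT hy]
  exact (isLUB_stochRevenues hm hα hβ hT).2 fun _ hv => stochRevenues_le hα hβ hT hy hm hv

theorem VDet_le_VStoch_add {m : ℕ} {α β T ρ : ℝ} (hm : 0 < m) (hα : 0 < α) (hβ : 0 ≤ β)
    (hρ : β ≤ ρ * α) (hT : 0 ≤ T) :
    VDet m α β T ≤ VStoch m α β T + (|ρ| + 2 + Real.log m) := by
  obtain ⟨y, hy⟩ := exists_isEndpoint (β := β) hα hT
  have h1 := mul_revenueToGo_le hα hβ hρ hT hy hm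
  have h2 := (isLUB_stochRevenues hm hα hβ hT).1 (log_expValue_mem_stochRevenues hm hα hβ hT)
  rw [VDet_eq hm hα hβ hT hy]
  linarith

/-- For m ≥ 2 the ratio log m / log 2 is at least 1, so lower powers of log m are absorbed into its
square. -/
theorem add_log_le_sqrt_mul_log_sq {c : ℝ} (hc : 0 ≤ c) {m : ℕ} (hm : 2 ≤ m) :
    c + Real.log m ≤ (c / Real.log 2 ^ 2 + 1 / Real.log 2) * (√(m : ℝ) * Real.log m ^ 2) := by
  have hm' : (2 : ℝ) ≤ m := by exact_mod_cast hm
  have h2 : 0 < Real.log 2 := Real.log_pos one_lt_two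
  have h1 : Real.log 2 ≤ Real.log m := Real.log_le_log two_pos hm'
  have h3 : 1 ≤ √(m : ℝ) := Real.one_le_sqrt.2 (by linarith)
  have h4 : c ≤ c / Real.log 2 ^ 2 * Real.log m ^ 2 := by
    rw [div_mul_eq_mul_div, le_div_iff₀ (by positivity)]
    gcongr
  have h5 : Real.log m ≤ 1 / Real.log 2 * Real.log m ^ 2 := by
    rw [one_div_mul_eq_div, le_div_iff₀ h2, sq]
    gcongr
  have h6 : Real.log m ^ 2 ≤ √(m : ℝ) * Real.log m ^ 2 := le_mul_of_one_le_left (sq_nonneg _) h3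
  calc c + Real.log m ≤ (c / Real.log 2 ^ 2 + 1 / Real.log 2) * Real.log m ^ 2 := by
        rw [add_mul]; linarith
    _ ≤ _ := by gcongr

end Bass

theorem lemma2 :
    -- both optimal revenues are genuine (finite) suprema, and pseudo-regret dominates regret
    (∀ (m : ℕ) (α β T : ℝ), 1 ≤ m → 0 < α → 0 ≤ β → 0 ≤ T →
      IsLUB (Bass.detRevenues m α β T) (Bass.VDet m α β T) ∧
      IsLUB (Bass.stochRevenues m α β T) (Bass.VStoch m α β T) ∧
      Bass.VStoch m α β T ≤ Bass.VDet m α β T ∧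
      ∀ (π : Bass.Policy T) (ω : Bass.Sample),
        Bass.regret m α β π ω ≤ Bass.pseudoRegret m α β π ω) ∧
    -- pseudo-regret exceeds regret by little; the constants depend only on a bound on `β / α`
    (∀ ρ : ℝ, ∃ (C : ℝ) (k : ℕ), ∀ (m : ℕ) (α β T : ℝ),
      2 ≤ m → 0 < α → 0 ≤ β → β ≤ ρ * α → 0 ≤ T →
      ∀ (π : Bass.Policy T) (ω : Bass.Sample),
        Bass.pseudoRegret m α β π ω ≤ Bass.regret m α β π ω +
          C * (√(m : ℝ) * Real.log m ^ 2 +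
            Real.posLog ((α + β) * T) *
              Real.log (m * Real.posLog ((α + β) * T)) ^ 2) ∧
        |Bass.pseudoRegret m α β π ω - Bass.regret m α β π ω| ≤
          C * √(m : ℝ) * (Real.log m + Real.posLog ((α + β) * T)) ^ k) := by
  constructor
  · intro m α β T hm hα hβ hT
    have hle := Bass.VStoch_le_VDet hm hα hβ hT
    obtain ⟨y, hy⟩ := Bass.exists_isEndpoint (β := β) hα hT
    refine ⟨?_, Bass.isLUB_stochRevenues hm hα hβ hT, hle, fun π ω => ?_⟩
    · rw [Bass.VDet_eq hm hα hβ hT hy]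
      exact Bass.isLUB_detRevenues hm hα hβ hT hy
    · exact sub_le_sub_right hle _
  · intro ρ
    refine ⟨(|ρ| + 2) / Real.log 2 ^ 2 + 1 / Real.log 2, 2, ?_⟩
    intro m α β T hm hα hβ hρ hT π ω
    have hm0 : 0 < m := by omega
    have hle := Bass.VStoch_le_VDet hm0 hα hβ hT
    have hgap := Bass.VDet_le_VStoch_add hm0 hα hβ hρ hT
    have hc : 0 ≤ |ρ| + 2 := by positivity
    have hbound := Bass.add_log_le_sqrt_mul_log_sq hc hm
    have h2 : 0 < Real.log 2 := Real.log_pos one_lt_two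
    set C := (|ρ| + 2) / Real.log 2 ^ 2 + 1 / Real.log 2
    have hC : 0 ≤ C := by positivity
    have hL : 0 ≤ Real.posLog ((α + β) * T) := Real.posLog_nonneg
    have hlogm : 0 ≤ Real.log m := Real.log_nonneg (by exact_mod_cast hm0)
    have hdiff : Bass.pseudoRegret m α β π ω - Bass.regret m α β π ω =
        Bass.VDet m α β T - Bass.VStoch m α β T := by
      simp only [Bass.pseudoRegret, Bass.regret]; ring
    constructor
    -- The horizon term is only needed to be nonnegative: the first term already covers the gap.
    · have h3 : 0 ≤ C * (Real.posLog ((α + β) * T) *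
          Real.log (m * Real.posLog ((α + β) * T)) ^ 2) := by positivity
      rw [mul_add]
      linarith
    · rw [hdiff, abs_of_nonneg (sub_nonneg.2 hle)]
      have h4 : C * (√(m : ℝ) * Real.log m ^ 2) ≤
          C * √(m : ℝ) * (Real.log m + Real.posLog ((α + β) * T)) ^ 2 := by
        rw [mul_assoc]
        gcongr
        linarith
      linarith
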